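/- Let $(M,\omega)$ be a compact simply connected symplectic manifold of dimension $2n$, $L\to M$ a smooth hermitian complex line bundle, and $a$ a smooth hermitian connection on $L$ with curvature $F_a=2\pi i\,\omega$. Let $\Gamma(M,L)$ be the complex vector space of smooth sections and $\mathbb P\Gamma(M,L)$ its projectivization. Fix a closed smooth $n$-manifold $N$ with a class $c\in H_n(N;\mathbb Z)$ (the fundamental class if $N$ is oriented) and $A\in H_n(M;\mathbb Z)$. Let $\mathcal B_S$ be the set of all smooth Bohr–Sommerfeld Lagrangian submanifolds $S\subset M$ of this type: $S=\iota(N)$ for a smooth Lagrangian embedding $\iota:N\to M$ with $\iota_*c=A$, such that $(L,a)|_S$ admits a smooth nowhere vanishing covariantly constant section. Let $\mathcal U_{SBS}(a)\subset\mathbb P\Gamma(M,L)\times\mathcal B_S$ be the set of pairs $([\alpha],S)$ such that $\alpha|_S=e^{i\theta}f\,\sigma_S$ for some nowhere vanishing covariantly constant section $\sigma_S$ of $(L,a)|_S$, some real constant $\theta$ and some strictly positive $f\in C^\infty(S,\mathbb R)$. For a nonzero $\alpha\in\Gamma(M,L)$ let $D_\alpha=\{\alpha=0\}$ and let $\rho(\alpha)=\nabla_a\alpha/\alpha$,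 a complex 1-form on $M\setminus D_\alpha$. Let $\mathbb P(D_\alpha)$ be the set of classes $[\beta]$ with $D_\beta=D_\alpha$ such that $\rho(\beta)-\rho(\alpha)$ is exact on $M\setminus D_\alpha$, and let $\mathbb P^0(D_\alpha)$ be the set of those $[\beta]\in\mathbb P(D_\alpha)$ with $\operatorname{Re}\rho(\beta)=\operatorname{Re}\rho(\alpha)$. For $F\in C^\infty(M,\mathbb R)$ let $P(F)[\alpha]=[e^{iF}\alpha]$. **Theorem ($\mathcal B_S$-covering).** Let $0\ne\alpha_0\in\Gamma(M,L)$, let $S_t=\phi_t(S_0)$, $t\in[0,1]$, be a Hamiltonian isotopy (with $\phi_t$ generated by a smooth time-dependent Hamiltonian, $\phi_0=\mathrm{id}$), and suppose that $([\alpha_0],S_0)\in\mathcal U_{SBS}(a)$ and $S_t\cap D_{\alpha_0}=\emptyset$ for all $t\in[0,1]$. Then there is a family of functions $F_t\in C^\infty(M,\mathbb R)$, smooth in $(t,x)\in[0,1]\times M$, with $F_0=0$, such that the classes $[\alpha_t]=P(F_t)[\alpha_0]$ satisfy $$([\alpha_t],S_t)\in\mathcal U_{SBS}(a)\quad\text{and}\quad[\alpha_t]\in\mathbb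 P^0(D_{\alpha_0})\qquad\text{for all }t\in[0,1].$$ -/

import Mathlib

open Bundle Set Filter Manifold
open scoped ContDiff Topology LinearAlgebra.Projectivization

universe u v

noncomputable section

namespace BohrSommerfeld

section Symplectic

variable (n : ℕ) (M : Type u) [TopologicalSpace M]
  [ChartedSpace (EuclideanSpace ℝ (Fin (2 * n))) M] [IsManifold (𝓡 (2 * n)) ∞ M]

/-- Smoothness of a vector field on `M`. -/
def IsSmoothField {n : ℕ} {M : Type u} [TopologicalSpace M]
    [ChartedSpace (EuclideanSpace ℝ (Fin (2 * n))) M] [IsManifold (𝓡 (2 * n)) ∞ M]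
    (X : ∀ x : M, TangentSpace (𝓡 (2 * n)) x) : Prop :=
  ContMDiff (𝓡 (2 * n)) (𝓡 (2 * n)).tangent ∞
    (fun x ↦ (⟨x, X x⟩ : TangentBundle (𝓡 (2 * n)) M))

/-- A symplectic form on the manifold `M` of dimension `2 n`: a smooth, alternating, nondegenerate
and closed 2-form. Closedness is expressed by the invariant formula for the exterior derivative,
evaluated on smooth vector fields. -/
structure SymplecticForm where
  toFun : ∀ x : M, TangentSpace (𝓡 (2 * n)) x →L[ℝ] TangentSpace (𝓡 (2 * n)) x →L[ℝ] ℝ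
  smooth : ContMDiff (𝓡 (2 * n))
    ((𝓡 (2 * n)).prod 𝓘(ℝ, EuclideanSpace ℝ (Fin (2 * n)) →L[ℝ]
      EuclideanSpace ℝ (Fin (2 * n)) →L[ℝ] ℝ)) ∞
    (fun x ↦ TotalSpace.mk' (EuclideanSpace ℝ (Fin (2 * n)) →L[ℝ]
      EuclideanSpace ℝ (Fin (2 * n)) →L[ℝ] ℝ) x (toFun x))
  alternating : ∀ x v, toFun x v v = 0
  nondegenerate : ∀ x v, (∀ w, toFun x v w = 0) → v = 0
  closed : ∀ X Y Z : (∀ x : M, TangentSpace (𝓡 (2 * n)) x),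
    IsSmoothField X → IsSmoothField Y → IsSmoothField Z → ∀ x,
      mvfderiv (𝓡 (2 * n)) (fun y ↦ toFun y (Y y) (Z y)) x (X x)
        - mvfderiv (𝓡 (2 * n)) (fun y ↦ toFun y (X y) (Z y)) x (Y x)
        + mvfderiv (𝓡 (2 * n)) (fun y ↦ toFun y (X y) (Y y)) x (Z x)
        - toFun x (VectorField.mlieBracket (𝓡 (2 * n)) X Y x) (Z x)
        + toFun x (VectorField.mlieBracket (𝓡 (2 * n)) X Z x) (Y x)
        - toFun x (VectorField.mlieBracket (𝓡 (2 * n)) Y Z x) (X x) = 0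

variable {n M}

/-- The family `S t`, `t ∈ [0, 1]`, of subsets of `M` is a Hamiltonian isotopy of `S 0`: there is a
smooth path `φ` of diffeomorphisms starting at the identity, generated by the Hamiltonian vector
fields `X t` of a smooth time-dependent Hamiltonian `H t`, such that `S t = φ t (S 0)`.
Values at times outside `[0, 1]` are irrelevant. -/
def IsHamiltonianIsotopy (Ω : SymplecticForm n M) (S : ℝ → Set M) : Prop :=
  ∃ (φ : ℝ → M ≃ₘ^∞⟮𝓡 (2 * n), 𝓡 (2 * n)⟯ M) (H : ℝ → M → ℝ)
    (X : ℝ → ∀ x : M, TangentSpace (𝓡 (2 * n)) x),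
    ContMDiffOn (𝓘(ℝ, ℝ).prod (𝓡 (2 * n))) (𝓡 (2 * n)) ∞
      (fun q : ℝ × M ↦ φ q.1 q.2) (Icc 0 1 ×ˢ univ) ∧
    ContMDiffOn (𝓘(ℝ, ℝ).prod (𝓡 (2 * n))) (𝓡 (2 * n)) ∞
      (fun q : ℝ × M ↦ (φ q.1).symm q.2) (Icc 0 1 ×ˢ univ) ∧
    ContMDiffOn (𝓘(ℝ, ℝ).prod (𝓡 (2 * n))) 𝓘(ℝ, ℝ) ∞
      (fun q : ℝ × M ↦ H q.1 q.2) (Icc 0 1 ×ˢ univ) ∧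
    (∀ t ∈ Icc (0 : ℝ) 1, ∀ x v,
      Ω.toFun x (X t x) v = mvfderiv (𝓡 (2 * n)) (H t) x v) ∧
    (∀ t ∈ Icc (0 : ℝ) 1, ∀ x,
      HasMFDerivWithinAt 𝓘(ℝ, ℝ) (𝓡 (2 * n)) (fun s ↦ φ s x) (Icc 0 1) t
        ((1 : ℝ →L[ℝ] ℝ).smulRight (X t (φ t x)))) ∧
    (∀ x, φ 0 x = x) ∧
    ∀ t ∈ Icc (0 : ℝ) 1, S t = φ t '' S 0

end Symplectic

section Homology

open CategoryTheory AlgebraicTopology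

/-- Singular homology `H_k(X; ℤ)`. -/
def integralHomology (k : ℕ) (X : Type u) [TopologicalSpace X] : ModuleCat.{u} ℤ :=
  ((singularHomologyFunctor (ModuleCat.{u} ℤ) k).obj (ModuleCat.of ℤ (ULift.{u} ℤ))).obj
    (TopCat.of X)

/-- The map induced on singular homology by a continuous map. -/
def integralHomologyMap (k : ℕ) {X Y : Type u} [TopologicalSpace X] [TopologicalSpace Y]
    (f : C(X, Y)) : integralHomology k X →ₗ[ℤ] integralHomology k Y :=
  (((singularHomologyFunctor (ModuleCat.{u} ℤ) k).obj (ModuleCat.of ℤ (ULift.{u} ℤ))).map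
    (TopCat.ofHom f)).hom

end Homology

section Prequantum

variable {n : ℕ} {M : Type u} [TopologicalSpace M]
  [ChartedSpace (EuclideanSpace ℝ (Fin (2 * n))) M]
  {L : M → Type v} [TopologicalSpace (TotalSpace ℂ L)]
  [∀ x, NormedAddCommGroup (L x)] [FiberBundle ℂ L]

/-- Smoothness of a section of the line bundle `L → M`, over the reals. -/
def IsSmoothSection (n : ℕ) {M : Type u} [TopologicalSpace M]
    [ChartedSpace (EuclideanSpace ℝ (Fin (2 * n))) M]
    {L : M → Type v} [TopologicalSpace (TotalSpace ℂ L)]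
    [∀ x, NormedAddCommGroup (L x)] [FiberBundle ℂ L] (s : ∀ x, L x) : Prop :=
  ContMDiff (𝓡 (2 * n)) ((𝓡 (2 * n)).prod 𝓘(ℝ, ℂ)) ∞ (fun x ↦ (⟨x, s x⟩ : TotalSpace ℂ L))

lemma isSmoothSection_iff {s : ∀ x, L x} : IsSmoothSection n s ↔
    ∀ x₀, ContMDiffAt (𝓡 (2 * n)) 𝓘(ℝ, ℂ) ∞
      (fun x ↦ (trivializationAt ℂ L x₀ ⟨x, s x⟩).2) x₀ :=
  ⟨fun h x₀ ↦ (contMDiffAt_section x₀).1 (h x₀), fun h x₀ ↦ (contMDiffAt_section x₀).2 (h x₀)⟩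

variable [∀ x, InnerProductSpace ℂ (L x)]

lemma trivializationAt_smul_snd [VectorBundle ℂ ℂ L] (x₀ : M) (z : M → ℂ) (s : ∀ x, L x) :
    (fun x ↦ (trivializationAt ℂ L x₀ ⟨x, z x • s x⟩).2) =ᶠ[𝓝 x₀]
      fun x ↦ z x * (trivializationAt ℂ L x₀ ⟨x, s x⟩).2 := by
  filter_upwards [(trivializationAt ℂ L x₀).open_baseSet.mem_nhds
    (mem_baseSet_trivializationAt ℂ L x₀)] with x hx
  exact ((trivializationAt ℂ L x₀).linear ℂ hx).map_smul (z x) (s x)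

lemma IsSmoothSection.smul [VectorBundle ℂ ℂ L] {s : ∀ x, L x} (hs : IsSmoothSection n s)
    {z : M → ℂ} (hz : ContMDiff (𝓡 (2 * n)) 𝓘(ℝ, ℂ) ∞ z) :
    IsSmoothSection n (fun x ↦ z x • s x) := by
  rw [isSmoothSection_iff] at hs ⊢
  intro x₀
  refine ContMDiffAt.congr_of_eventuallyEq ?_ (trivializationAt_smul_snd x₀ z s)
  exact ((contDiff_mul (𝕜 := ℝ) (𝔸 := ℂ) (n := ∞)).contMDiff.contMDiffAt).comp x₀
    ((hz x₀).prodMk_space (hs x₀))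

lemma IsSmoothSection.add [VectorBundle ℂ ℂ L] {s s' : ∀ x, L x} (hs : IsSmoothSection n s)
    (hs' : IsSmoothSection n s') : IsSmoothSection n (fun x ↦ s x + s' x) := by
  rw [isSmoothSection_iff] at hs hs' ⊢
  intro x₀
  refine ContMDiffAt.congr_of_eventuallyEq ((hs x₀).add (hs' x₀)) ?_
  filter_upwards [(trivializationAt ℂ L x₀).open_baseSet.mem_nhds
    (mem_baseSet_trivializationAt ℂ L x₀)] with x hx
  exact ((trivializationAt ℂ L x₀).linear ℂ hx).map_add (s x) (s' x)

lemma IsSmoothSection.zero [VectorBundle ℂ ℂ L] : IsSmoothSection n (fun x ↦ (0 : L x)) := by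
  rw [isSmoothSection_iff]
  intro x₀
  refine ContMDiffAt.congr_of_eventuallyEq (contMDiffAt_const (c := (0 : ℂ))) ?_
  filter_upwards [(trivializationAt ℂ L x₀).open_baseSet.mem_nhds
    (mem_baseSet_trivializationAt ℂ L x₀)] with x hx
  exact ((trivializationAt ℂ L x₀).linear ℂ hx).map_zero

variable (n L) in
/-- The complex vector space `Γ(M, L)` of smooth sections. -/
def SmoothSections [VectorBundle ℂ ℂ L] : Submodule ℂ (∀ x, L x) where
  carrier := {s | IsSmoothSection n s}
  add_mem' hs hs' := hs.add hs'
  zero_mem' := IsSmoothSection.zero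
  smul_mem' z _ hs := hs.smul (contMDiff_const (c := z))

/-- The zero set `D_α` of a section. -/
def zeroLocus (s : ∀ x, L x) : Set M := {x | s x = 0}

/-- Multiplication of sections by the phase factor `e^{iF}`. -/
def phaseMul [VectorBundle ℂ ℂ L] (F : C^∞⟮𝓡 (2 * n), M; 𝓘(ℝ, ℝ), ℝ⟯) :
    SmoothSections n L →ₗ[ℂ] SmoothSections n L where
  toFun s := ⟨fun x ↦ Complex.exp (Complex.I * (F x : ℂ)) • s.1 x, by
    refine IsSmoothSection.smul s.2 ?_
    have h : ContDiff ℝ ∞ fun r : ℝ ↦ Complex.exp (Complex.I * (r : ℂ)) :=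
      (contDiff_const.mul Complex.ofRealCLM.contDiff).cexp
    exact h.contMDiff.comp F.contMDiff⟩
  map_add' s s' := by ext x; exact smul_add _ _ _
  map_smul' z s := by ext x; exact smul_comm _ _ _

lemma phaseMul_injective [VectorBundle ℂ ℂ L] (F : C^∞⟮𝓡 (2 * n), M; 𝓘(ℝ, ℝ), ℝ⟯) :
    Function.Injective (phaseMul (L := L) F) := by
  intro s s' h
  ext x
  have hx : Complex.exp (Complex.I * (F x : ℂ)) • s.1 x =
      Complex.exp (Complex.I * (F x : ℂ)) • s'.1 x := congrFun (congrArg Subtype.val h) x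
  exact smul_right_injective _ (Complex.exp_ne_zero _) hx

/-- The phase transformation `P(F) : [α] ↦ [e^{iF} α]` of the projective space `ℙ Γ(M, L)`. -/
def phase [VectorBundle ℂ ℂ L] (F : C^∞⟮𝓡 (2 * n), M; 𝓘(ℝ, ℝ), ℝ⟯) :
    ℙ ℂ (SmoothSections n L) → ℙ ℂ (SmoothSections n L) :=
  Projectivization.map (phaseMul F) (phaseMul_injective F)

variable (n L) in
/-- The hermitian structure on `L` is smooth. -/
def IsSmoothHermitian : Prop :=
  ∀ s s' : (∀ x, L x), IsSmoothSection n s → IsSmoothSection n s' →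
    ContMDiff (𝓡 (2 * n)) 𝓘(ℝ, ℂ) ∞ (fun x ↦ inner ℂ (s x) (s' x))

variable [IsManifold (𝓡 (2 * n)) ∞ M] [VectorBundle ℝ ℂ L]

/-- `a` belongs to `𝓞(Ω)`: it is a smooth hermitian connection on the complex line bundle `L`
whose curvature is `F_a = 2 π i Ω`. -/
structure IsPrequantum (Ω : SymplecticForm n M) (a : CovariantDerivative (𝓡 (2 * n)) ℂ L) :
    Prop where
  smooth : CovariantDerivative.ContMDiffCovariantDerivative a ∞
  complexLinear : ∀ s : (∀ x, L x), IsSmoothSection n s → ∀ x v,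
    a (fun y ↦ Complex.I • s y) x v = Complex.I • a s x v
  hermitian : ∀ s s' : (∀ x, L x), IsSmoothSection n s → IsSmoothSection n s' → ∀ x v,
    mvfderiv (𝓡 (2 * n)) (fun y ↦ inner ℂ (s y) (s' y)) x v
      = inner ℂ (a s x v) (s' x) + inner ℂ (s x) (a s' x v)
  curvature : ∀ (X Y : ∀ x : M, TangentSpace (𝓡 (2 * n)) x) (s : ∀ x, L x),
    IsSmoothField X → IsSmoothField Y → IsSmoothSection n s → ∀ x,
      a (fun y ↦ a s y (Y y)) x (X x) - a (fun y ↦ a s y (X y)) x (Y x)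
        - a s x (VectorField.mlieBracket (𝓡 (2 * n)) X Y x)
      = (2 * Real.pi * Ω.toFun x (X x) (Y x) * Complex.I : ℂ) • s x

/-- The complex 1-form `ρ(α) = (∇_a α) / α`; it is meaningful outside the zero set of `α`. -/
def rho (a : CovariantDerivative (𝓡 (2 * n)) ℂ L) (α : ∀ x, L x) (x : M)
    (v : TangentSpace (𝓡 (2 * n)) x) : ℂ :=
  inner ℂ (α x) (a α x v) / (‖α x‖ : ℂ) ^ 2

section Leaf

variable [VectorBundle ℂ ℂ L]

/-- The affine space `ℙ(D_α)` attached to a nonzero section `α`: classes of sections `β` with the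
same zero set as `α` and such that `ρ(β) - ρ(α)` is an exact complex 1-form on `M \ D_α`. -/
def divisorSpace (a : CovariantDerivative (𝓡 (2 * n)) ℂ L) (α : SmoothSections n L) :
    Set (ℙ ℂ (SmoothSections n L)) :=
  {p | ∃ (β : SmoothSections n L) (hβ : β ≠ 0), p = Projectivization.mk ℂ β hβ ∧
    zeroLocus β.1 = zeroLocus α.1 ∧
    ∃ G : M → ℂ, ContMDiffOn (𝓡 (2 * n)) 𝓘(ℝ, ℂ) ∞ G (zeroLocus α.1)ᶜ ∧
      ∀ x ∉ zeroLocus α.1, ∀ v, rho a β.1 x v = rho a α.1 x v + mvfderiv (𝓡 (2 * n)) G x v}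

/-- The leaf `ℙ⁰(D_α)` through `[α]`: the classes `[β]` in `ℙ(D_α)` for which
`Re ρ(β) = Re ρ(α)` on `M \ D_α`. -/
def leaf (a : CovariantDerivative (𝓡 (2 * n)) ℂ L) (α : SmoothSections n L) :
    Set (ℙ ℂ (SmoothSections n L)) :=
  {p | p ∈ divisorSpace a α ∧
    ∃ (β : SmoothSections n L) (hβ : β ≠ 0), p = Projectivization.mk ℂ β hβ ∧
      ∀ x ∉ zeroLocus α.1, ∀ v, (rho a β.1 x v).re = (rho a α.1 x v).re}

end Leaf

section Lagrangian

variable {N : Type u} [TopologicalSpace N] [ChartedSpace (EuclideanSpace ℝ (Fin n)) N]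

/-- `σ` is a smooth section, along the map `ι : N → M`, of the bundle `L`. -/
def IsSmoothAlong (ι : N → M) (σ : ∀ y : N, L (ι y)) : Prop :=
  ContMDiff (𝓡 n) ((𝓡 (2 * n)).prod 𝓘(ℝ, ℂ)) ∞ (fun y ↦ (⟨ι y, σ y⟩ : TotalSpace ℂ L))

/-- `σ` is covariantly constant for the pullback of `a` to `N`: whenever `σ = g • (s ∘ ι)` near `y`
with `s` a smooth section of `L` and `g` a function differentiable at `y`, the pullback derivative
`dg(v) s + g ∇_{dι(v)} s` vanishes at `y` for all tangent vectors `v`. -/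
def IsParallelAlong (a : CovariantDerivative (𝓡 (2 * n)) ℂ L) (ι : N → M)
    (σ : ∀ y : N, L (ι y)) : Prop :=
  ∀ (y : N) (s : ∀ x, L x) (g : N → ℂ), IsSmoothSection n s →
    MDifferentiableAt (𝓡 n) 𝓘(ℝ, ℂ) g y → (∀ᶠ z in 𝓝 y, σ z = g z • s (ι z)) →
    ∀ v : TangentSpace (𝓡 n) y,
      mvfderiv (𝓡 n) g y v • s (ι y)
        + g y • a s (ι y) (mfderiv (𝓡 n) (𝓡 (2 * n)) ι y v) = 0

/-- `σ` trivializes the restriction of `(L, a)` to `N`: it is a smooth, nowhere vanishing,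
covariantly constant section. -/
structure IsFlatFrame (a : CovariantDerivative (𝓡 (2 * n)) ℂ L) (ι : N → M)
    (σ : ∀ y : N, L (ι y)) : Prop where
  smooth : IsSmoothAlong (n := n) ι σ
  ne_zero : ∀ y, σ y ≠ 0
  parallel : IsParallelAlong a ι σ

/-- `ι` is a smooth Lagrangian embedding of the `n`-manifold `N` into `(M, Ω)` which satisfies the
Bohr–Sommerfeld condition and maps the homology class `c` of `N` to the class `A`. For oriented `N`
one takes for `c` the fundamental class. -/
structure IsBSEmbedding (Ω : SymplecticForm n M) (a : CovariantDerivative (𝓡 (2 * n)) ℂ L)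
    (c : integralHomology n N) (A : integralHomology n M) (ι : C(N, M)) : Prop where
  embedding : IsSmoothEmbedding (𝓡 n) (𝓡 (2 * n)) ∞ ι
  lagrangian : ∀ (y : N) (v w : TangentSpace (𝓡 n) y),
    Ω.toFun (ι y) (mfderiv (𝓡 n) (𝓡 (2 * n)) ι y v) (mfderiv (𝓡 n) (𝓡 (2 * n)) ι y w) = 0
  bohrSommerfeld : ∃ σ : (∀ y : N, L (ι y)), IsFlatFrame a ι σ
  homology : integralHomologyMap n ι c = A

/-- The space `𝓑_S` of smooth Bohr–Sommerfeld Lagrangian submanifolds of `M` of topological type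
`N` and homology class `A`, as a set of subsets of `M`. -/
def bsLagrangians (Ω : SymplecticForm n M) (a : CovariantDerivative (𝓡 (2 * n)) ℂ L)
    (c : integralHomology n N) (A : integralHomology n M) : Set (Set M) :=
  {S | ∃ ι : C(N, M), IsBSEmbedding Ω a c A ι ∧ range ι = S}

/-- The speciality condition: `α|_S = e^{iθ} f σ_S` with `σ_S` covariantly constant, `θ` a real
constant and `f` a strictly positive smooth function. -/
def IsSpecialAlong (a : CovariantDerivative (𝓡 (2 * n)) ℂ L) (α : ∀ x, L x) (ι : N → M) : Prop :=
  ∃ (σ : ∀ y : N, L (ι y)) (θ : ℝ) (f : N → ℝ), IsFlatFrame a ι σ ∧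
    ContMDiff (𝓡 n) 𝓘(ℝ, ℝ) ∞ f ∧ (∀ y, 0 < f y) ∧
    ∀ y, α (ι y) = (Complex.exp (Complex.I * (θ : ℂ)) * (f y : ℂ)) • σ y

/-- The universal space `𝓤_SBS(a)` inside `ℙ Γ(M, L) × 𝓑_S`. -/
def universalSBS [VectorBundle ℂ ℂ L] (Ω : SymplecticForm n M)
    (a : CovariantDerivative (𝓡 (2 * n)) ℂ L)
    (c : integralHomology n N) (A : integralHomology n M) :
    Set (ℙ ℂ (SmoothSections n L) × Set M) :=
  {q | q.2 ∈ bsLagrangians Ω a c A ∧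
    ∃ (α : SmoothSections n L) (hα : α ≠ 0), q.1 = Projectivization.mk ℂ α hα ∧
    ∃ ι : C(N, M), IsBSEmbedding Ω a c A ι ∧ range ι = q.2 ∧ IsSpecialAlong a α.1 ι}

end Lagrangian

end Prequantum

end BohrSommerfeld

end

/-!
Let `ρ(α) = ∇α / α`. Off the zeros of `α`, the form `Re ρ(α)` is `d log ‖α‖`, because the connection
is hermitian (`mvfderiv_normSq`), and `dρ(α) = 2πi Ω`, because `2πi Ω` is the curvature
(`fderiv_rho_mfderiv_sub_swap`). Along a submanifold `ι : N → M` that avoids the zeros of `α`, the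
section `e^l α` is covariantly constant if and only if `dl = -ι^*ρ(α)`. Hence special
Bohr–Sommerfeld submanifolds are exactly those on which `Im ρ(α) = 0`
(`im_rho_eq_zero_of_isFlatFrame`), and when `ι^*(Im ρ(α))` is `-d(F ∘ ι)` for a function `F` on `M`,
the section `e^{iF} α / ‖α‖` is a flat frame along `ι`, so that `e^{iF} α` satisfies the speciality
condition (`isSpecialAlong_phaseMul`).

Let `φ t` be the flow of the Hamiltonian vector fields `X t` of `H t`, put `ι t = φ t ∘ ι`, and let
`Im ρ(α)` vanish along `ι`. Cartan's formula gives
`∂ₜ (ι t)^*(Im ρ) = d(Im ρ(X t) ∘ ι t) + 2π (ι t)^*(Ω(X t, ·)) = d((Im ρ(X t) + 2π H t) ∘ ι t)`,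
so `(ι t)^*(Im ρ)` is the differential of the primitive in time
`g t = ∫₀ᵗ (Im ρ(X s) + 2π H s) ∘ ι s ds` (`im_rho_eq_mvfderiv_primitive`). In particular it is
closed, so that `ι t` is again Lagrangian (`symplecticForm_eq_zero_of_im_rho_eq`).

It remains to find smooth functions `F t` on `M` with `F t ∘ ι t = -g t`. The definition of `g t`
makes sense on all of `M` once `Im ρ(X s)` is multiplied by a cutoff function that is `1` on the
compact union of the images of the `ι s` and vanishes near the zeros of `α`; composing with the
inverse of `φ t` gives `F t` (`exists_phase`). Smoothness up to the end points of `[0, 1]` follows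
from differentiation under the integral sign (`contMDiffOn_primitive`).

A phase transformation adds the exact form `i dF` to `ρ(α)` (`rho_phaseMul`), and therefore
preserves the leaves (`phase_mk_mem_leaf`). The homology class of `ι t` does not change, by homotopy
invariance.
-/

set_option linter.unusedSectionVars false

namespace BohrSommerfeld

/-! ### Primitives of smooth families on a compact time interval -/

section Primitive

open MeasureTheory

variable {E F : Type*} [NormedAddCommGroup E] [NormedAddCommGroup F] {T : Set E}

lemma continuousOn_time_slice {k : ℝ × E → F} (hk : ContinuousOn k (Icc (0 : ℝ) 1 ×ˢ T))
    {z : E} (hz : z ∈ T) : ContinuousOn (fun s : ℝ ↦ k (s, z)) (Icc 0 1) :=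
  hk.comp (by fun_prop) fun _ hs ↦ ⟨hs, hz⟩

lemma intervalIntegrable_time_slice {k : ℝ × E → F} (hk : ContinuousOn k (Icc (0 : ℝ) 1 ×ˢ T))
    {z : E} (hz : z ∈ T) {t t' : ℝ} (ht : t ∈ Icc (0 : ℝ) 1) (ht' : t' ∈ Icc (0 : ℝ) 1) :
    IntervalIntegrable (fun s : ℝ ↦ k (s, z)) volume t t' :=
  ((continuousOn_time_slice hk hz).mono (uIcc_subset_Icc ht ht')).intervalIntegrable

variable [NormedSpace ℝ F]

lemma continuousOn_primitive_param {k : ℝ × E → F} (hk : ContinuousOn k (Icc (0 : ℝ) 1 ×ˢ T)) :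
    ContinuousOn (fun q : ℝ × E ↦ ∫ s in (0 : ℝ)..q.1, k (s, q.2)) (Icc (0 : ℝ) 1 ×ˢ T) := by
  -- clamping the time variable makes the integrand continuous for all times
  have h1 : Continuous (Function.uncurry fun (p : (Icc (0 : ℝ) 1 ×ˢ T : Set (ℝ × E))) (s : ℝ) ↦
      k ((projIcc (0 : ℝ) 1 zero_le_one s : ℝ), p.1.2)) := by
    refine hk.comp_continuous (by fun_prop) fun q ↦ ⟨Subtype.coe_prop _, q.1.2.2⟩
  have h2 := intervalIntegral.continuous_parametric_intervalIntegral_of_continuous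
    (μ := volume) (a₀ := 0) h1 (s := fun p ↦ p.1.1) (by fun_prop)
  rw [continuousOn_iff_continuous_domRestrict]
  refine h2.congr fun p ↦ ?_
  refine intervalIntegral.integral_congr fun s hs ↦ ?_
  have : s ∈ Icc (0 : ℝ) 1 := uIcc_subset_Icc (by simp) p.2.1 hs
  simp [projIcc_of_mem zero_le_one this]

variable [NormedSpace ℝ E] [FiniteDimensional ℝ E]

/-- Differentiation under the integral sign. -/
lemma hasFDerivAt_primitive_param {k : ℝ × E → F} (hT : IsOpen T)
    (hk : ContDiffOn ℝ 1 k (Icc (0 : ℝ) 1 ×ˢ T)) {t : ℝ} (ht : t ∈ Icc (0 : ℝ) 1) {z : E}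
    (hz : z ∈ T) :
    HasFDerivAt (fun y ↦ ∫ s in (0 : ℝ)..t, k (s, y))
      (∫ s in (0 : ℝ)..t, (fderivWithin ℝ k (Icc (0 : ℝ) 1 ×ˢ T) (s, z)).comp
        (ContinuousLinearMap.inr ℝ ℝ E)) z := by
  have hU : UniqueDiffOn ℝ (Icc (0 : ℝ) 1 ×ˢ T) :=
    (uniqueDiffOn_Icc zero_lt_one).prod hT.uniqueDiffOn
  set k' : ℝ × E → E →L[ℝ] F := fun q ↦ (fderivWithin ℝ k (Icc (0 : ℝ) 1 ×ˢ T) q).comp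
        (ContinuousLinearMap.inr ℝ ℝ E) with hk'
  have hk'c : ContinuousOn k' (Icc (0 : ℝ) 1 ×ˢ T) :=
    (hk.continuousOn_fderivWithin hU le_rfl).clm_comp continuousOn_const
  obtain ⟨ε, hε, hεT⟩ := Metric.nhds_basis_closedBall.mem_iff.1 (hT.mem_nhds hz)
  have hcpt : IsCompact (Icc (0 : ℝ) 1 ×ˢ Metric.closedBall z ε) :=
    isCompact_Icc.prod (isCompact_closedBall z ε)
  obtain ⟨C, hC⟩ := hcpt.exists_bound_of_continuousOn (hk'c.mono (prod_mono le_rfl hεT))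
  have h01 : (0 : ℝ) ∈ Icc (0 : ℝ) 1 := by simp
  have hmem : ∀ s ∈ uIoc 0 t, s ∈ Icc (0 : ℝ) 1 := fun s hs ↦
    uIcc_subset_Icc h01 ht (uIoc_subset_uIcc hs)
  refine intervalIntegral.hasFDerivAt_integral_of_dominated_of_fderiv_le (bound := fun _ ↦ C)
    (F := fun y s ↦ k (s, y)) (F' := fun y s ↦ k' (s, y))
    (Metric.closedBall_mem_nhds z hε) ?_ ?_ ?_ ?_ ?_ ?_
  · filter_upwards [hT.mem_nhds hz] with y hy
    exact (intervalIntegrable_time_slice hk.continuousOn hy h01 ht).def'.aestronglyMeasurable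
  · exact intervalIntegrable_time_slice hk.continuousOn hz h01 ht
  · exact (intervalIntegrable_time_slice hk'c hz h01 ht).def'.aestronglyMeasurable
  · exact Eventually.of_forall fun s hs y hy ↦ hC (s, y) ⟨hmem s hs, hy⟩
  · exact intervalIntegrable_const
  · refine Eventually.of_forall fun s hs y hy ↦ ?_
    have h1 : HasFDerivWithinAt k (fderivWithin ℝ k (Icc (0 : ℝ) 1 ×ˢ T) (s, y))
        (Icc (0 : ℝ) 1 ×ˢ T) (s, y) :=
      (hk.differentiableOn one_ne_zero _ ⟨hmem s hs, hεT hy⟩).hasFDerivWithinAt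
    have h2 : HasFDerivWithinAt (fun y : E ↦ (s, y)) (ContinuousLinearMap.inr ℝ ℝ E) T y :=
      (hasFDerivAt_prodMk_right s y).hasFDerivWithinAt
    exact (h1.comp y h2 fun x hx ↦ ⟨hmem s hs, hx⟩).hasFDerivAt (hT.mem_nhds (hεT hy))

variable [CompleteSpace F]

lemma hasFDerivWithinAt_primitive_param {k : ℝ × E → F} (hT : IsOpen T)
    (hk : ContDiffOn ℝ 1 k (Icc (0 : ℝ) 1 ×ˢ T)) {q : ℝ × E} (hq : q ∈ Icc (0 : ℝ) 1 ×ˢ T) :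
    HasFDerivWithinAt (fun q : ℝ × E ↦ ∫ s in (0 : ℝ)..q.1, k (s, q.2))
      ((ContinuousLinearMap.fst ℝ ℝ E).smulRight (k q) +
        (∫ s in (0 : ℝ)..q.1, (fderivWithin ℝ k (Icc (0 : ℝ) 1 ×ˢ T) (s, q.2)).comp
        (ContinuousLinearMap.inr ℝ ℝ E)).comp (ContinuousLinearMap.snd ℝ ℝ E))
      (Icc (0 : ℝ) 1 ×ˢ T) q := by
  obtain ⟨t, z⟩ := q
  have h01 : (0 : ℝ) ∈ Icc (0 : ℝ) 1 := by simp
  have h2 : HasFDerivWithinAt (fun q : ℝ × E ↦ ∫ s in (0 : ℝ)..t, k (s, q.2)) _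
      (Icc (0 : ℝ) 1 ×ˢ T) (t, z) :=
    ((hasFDerivAt_primitive_param hT hk hq.1 hq.2).comp (t, z)
      (hasFDerivAt_snd (𝕜 := ℝ) (E := ℝ) (F := E) (p := (t, z)))).hasFDerivWithinAt
  have h1 : HasFDerivWithinAt (fun q : ℝ × E ↦ ∫ s in t..q.1, k (s, q.2))
      ((ContinuousLinearMap.fst ℝ ℝ E).smulRight (k (t, z))) (Icc (0 : ℝ) 1 ×ˢ T) (t, z) := by
    rw [hasFDerivWithinAt_iff_isLittleO, Asymptotics.isLittleO_iff]
    intro c hc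
    have hcont := hk.continuousOn (t, z) hq
    obtain ⟨δ, hδ, hδ'⟩ := Metric.continuousWithinAt_iff.1 hcont c hc
    filter_upwards [self_mem_nhdsWithin, mem_nhdsWithin_of_mem_nhds (Metric.ball_mem_nhds _ hδ)]
      with p hp hpδ
    have hint := intervalIntegrable_time_slice hk.continuousOn hp.2 hq.1 hp.1
    have hbd : ∀ s ∈ uIoc t p.1, ‖k (s, p.2) - k (t, z)‖ ≤ c := by
      intro s hs
      have hs' := uIoc_subset_uIcc hs
      have hs1 : |s - t| ≤ |p.1 - t| := abs_sub_left_of_mem_uIcc hs'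
      have : dist (s, p.2) (t, z) < δ := by
        rw [Metric.mem_ball, Prod.dist_eq, max_lt_iff] at hpδ
        rw [Prod.dist_eq, max_lt_iff]
        exact ⟨hs1.trans_lt hpδ.1, hpδ.2⟩
      have := hδ' (x := (s, p.2)) ⟨uIcc_subset_Icc hq.1 hp.1 hs', hp.2⟩ this
      rw [dist_eq_norm] at this
      exact this.le
    have := intervalIntegral.norm_integral_le_of_norm_le_const hbd
    rw [intervalIntegral.integral_sub hint intervalIntegrable_const,
      intervalIntegral.integral_const] at this
    have h3 : |p.1 - t| ≤ ‖p - (t, z)‖ := norm_fst_le (p - (t, z))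
    calc _ = ‖(∫ s in t..p.1, k (s, p.2)) - (p.1 - t) • k (t, z)‖ := by simp
      _ ≤ _ := this.trans (by gcongr)
  refine HasFDerivWithinAt.congr' (h1.add h2) (fun p hp ↦ ?_) hq
  exact ((add_comm _ _).trans (intervalIntegral.integral_add_adjacent_intervals
    (intervalIntegrable_time_slice hk.continuousOn hp.2 h01 hq.1)
    (intervalIntegrable_time_slice hk.continuousOn hp.2 hq.1 hp.1))).symm

end Primitive

section PrimitiveSmooth

variable {E : Type u} [NormedAddCommGroup E] [NormedSpace ℝ E] [FiniteDimensional ℝ E] {T : Set E}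

/-- The induction on the order of smoothness passes from `F`-valued to `E →L[ℝ] F`-valued families,
so `F` is quantified inside the statement, and `E` and `F` share a universe. -/
lemma contDiffOn_primitive_param_nat (hT : IsOpen T) (m : ℕ) :
    ∀ {F : Type u} [NormedAddCommGroup F] [NormedSpace ℝ F] [CompleteSpace F] {k : ℝ × E → F},
    ContDiffOn ℝ m k (Icc (0 : ℝ) 1 ×ˢ T) →
    ContDiffOn ℝ m (fun q : ℝ × E ↦ ∫ s in (0 : ℝ)..q.1, k (s, q.2)) (Icc (0 : ℝ) 1 ×ˢ T) := by
  have hU : UniqueDiffOn ℝ (Icc (0 : ℝ) 1 ×ˢ T) :=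
    (uniqueDiffOn_Icc zero_lt_one).prod hT.uniqueDiffOn
  induction m with
  | zero =>
    intro F _ _ _ k hk
    rw [Nat.cast_zero, contDiffOn_zero] at hk ⊢
    exact continuousOn_primitive_param hk
  | succ m ih =>
    intro F _ _ _ k hk
    push_cast at hk ⊢
    rw [contDiffOn_succ_iff_hasFDerivWithinAt_of_uniqueDiffOn hU]
    refine ⟨by simp, _, ?_, fun q hq ↦
      hasFDerivWithinAt_primitive_param hT (hk.of_le (by simp)) hq⟩
    refine (contDiffOn_const.smulRight (hk.of_le (by simp))).add (ContDiffOn.clm_comp ?_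
      contDiffOn_const)
    exact ih ((((contDiffOn_succ_iff_fderivWithin hU).1 hk).2.2).clm_comp contDiffOn_const)

/-- Integrating a smooth family over `[0, t]` gives a function which is smooth in `t` and in the
parameter, up to the end points of the time interval. -/
lemma contDiffOn_primitive_param (hT : IsOpen T) {F : Type u} [NormedAddCommGroup F]
    [NormedSpace ℝ F] [CompleteSpace F] {k : ℝ × E → F}
    (hk : ContDiffOn ℝ ∞ k (Icc (0 : ℝ) 1 ×ˢ T)) :
    ContDiffOn ℝ ∞ (fun q : ℝ × E ↦ ∫ s in (0 : ℝ)..q.1, k (s, q.2)) (Icc (0 : ℝ) 1 ×ˢ T) :=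
  contDiffOn_infty.2 fun m ↦
    contDiffOn_primitive_param_nat hT m (hk.of_le (by exact_mod_cast le_top))

end PrimitiveSmooth

/-! ### The connection form of a section off its zero set -/

section ConnectionForm

variable {n : ℕ} {M : Type u} [TopologicalSpace M]
  [ChartedSpace (EuclideanSpace ℝ (Fin (2 * n))) M]
  {L : M → Type v} [TopologicalSpace (TotalSpace ℂ L)]
  [∀ x, NormedAddCommGroup (L x)] [∀ x, InnerProductSpace ℂ (L x)]
  [FiberBundle ℂ L] [VectorBundle ℂ ℂ L]

lemma exists_eq_smul_of_ne_zero {x : M} {e : L x} (he : e ≠ 0) (w : L x) : ∃ z : ℂ, w = z • e := by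
  let T := (trivializationAt ℂ L x).continuousLinearEquivAt ℂ x
    (mem_baseSet_trivializationAt ℂ L x)
  have hT : T e ≠ 0 := by simpa using he
  refine ⟨T w / T e, T.injective ?_⟩
  rw [map_smul, smul_eq_mul, div_mul_cancel₀ _ hT]

lemma inner_smul_div_normSq {x : M} {e : L x} (he : e ≠ 0) (z : ℂ) :
    inner ℂ e (z • e) / (‖e‖ : ℂ) ^ 2 = z := by
  have h : (‖e‖ : ℂ) ≠ 0 := by simpa using he
  rw [inner_smul_right, inner_self_eq_norm_sq_to_K]
  exact mul_div_cancel_right₀ z (pow_ne_zero 2 h)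

lemma trivializationAt_snd_eq_zero_iff (p : M) {x : M}
    (hx : x ∈ (trivializationAt ℂ L p).baseSet) (w : L x) :
    (trivializationAt ℂ L p ⟨x, w⟩).2 = 0 ↔ w = 0 :=
  ((trivializationAt ℂ L p).continuousLinearEquivAt ℂ x hx).map_eq_zero_iff

lemma eventually_trivializationAt_ne_zero {α : ∀ x, L x} (hα : IsSmoothSection n α) {p : M}
    (hp : α p ≠ 0) : ∀ᶠ x in 𝓝 p, x ∈ (trivializationAt ℂ L p).baseSet ∧ α x ≠ 0 := by
  have hpb := mem_baseSet_trivializationAt ℂ L p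
  have hc := (contMDiffAt_section p).1 (hα p)
  filter_upwards [(trivializationAt ℂ L p).open_baseSet.eventually_mem hpb,
    hc.continuousAt.eventually_ne (mt (trivializationAt_snd_eq_zero_iff p hpb _).1 hp)]
    with x hx h
  exact ⟨hx, mt (trivializationAt_snd_eq_zero_iff p hx _).2 h⟩

variable [IsManifold (𝓡 (2 * n)) ∞ M] [VectorBundle ℝ ℂ L]
  {a : CovariantDerivative (𝓡 (2 * n)) ℂ L} {α : ∀ x, L x}

lemma rho_eq_of_eq_smul {x : M} {v : TangentSpace (𝓡 (2 * n)) x} (hx : α x ≠ 0) {z : ℂ}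
    (h : a α x v = z • α x) : rho a α x v = z := by
  rw [rho, h, inner_smul_div_normSq hx]

lemma rho_smul_eq {x : M} (v : TangentSpace (𝓡 (2 * n)) x) (hx : α x ≠ 0) :
    rho a α x v • α x = a α x v := by
  obtain ⟨z, hz⟩ := exists_eq_smul_of_ne_zero hx (a α x v)
  rw [rho_eq_of_eq_smul hx hz, hz]

variable (a α) in
/-- The complex 1-form `ρ(α)` at the point `x`, as a continuous linear form. -/
noncomputable def rhoCLM (x : M) : TangentSpace (𝓡 (2 * n)) x →L[ℝ] ℂ :=
  ((((‖α x‖ : ℂ) ^ 2)⁻¹ • innerSL ℂ (α x)).restrictScalars ℝ).comp (a α x)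

lemma rhoCLM_apply (x : M) (v : TangentSpace (𝓡 (2 * n)) x) : rhoCLM a α x v = rho a α x v := by
  change ((‖α x‖ : ℂ) ^ 2)⁻¹ * inner ℂ (α x) (a α x v) = _
  rw [rho, div_eq_inv_mul]

/-- The Leibniz rule for complex-valued functions, which holds for a real covariant derivative that
commutes with multiplication by `i`. -/
lemma leibniz_complex
    (ha : ∀ s : (∀ x, L x), IsSmoothSection n s → ∀ x v,
      a (fun y ↦ Complex.I • s y) x v = Complex.I • a s x v)
    (hα : IsSmoothSection n α) {h : M → ℂ} {x : M}
    (hh : MDifferentiableAt (𝓡 (2 * n)) 𝓘(ℝ, ℂ) h x) (v : TangentSpace (𝓡 (2 * n)) x) :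
    a (fun y ↦ h y • α y) x v = h x • a α x v + mvfderiv (𝓡 (2 * n)) h x v • α x := by
  have hre : HasMFDerivAt (𝓡 (2 * n)) 𝓘(ℝ, ℝ) (fun y ↦ (h y).re) x
      (Complex.reCLM.comp (mfderiv (𝓡 (2 * n)) 𝓘(ℝ, ℂ) h x)) :=
    (Complex.reCLM.hasMFDerivAt (x := h x)).comp x hh.hasMFDerivAt
  have him : HasMFDerivAt (𝓡 (2 * n)) 𝓘(ℝ, ℝ) (fun y ↦ (h y).im) x
      (Complex.imCLM.comp (mfderiv (𝓡 (2 * n)) 𝓘(ℝ, ℂ) h x)) :=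
    (Complex.imCLM.hasMFDerivAt (x := h x)).comp x hh.hasMFDerivAt
  have hα' := (hα x).mdifferentiableAt (by simp)
  have hI : IsSmoothSection n (fun y ↦ Complex.I • α y) := hα.smul contMDiff_const
  have hIα' := (hI x).mdifferentiableAt (by simp)
  have hsplit : (fun y ↦ h y • α y) = (fun y ↦ (h y).re) • α +
      (fun y ↦ (h y).im) • (fun y ↦ Complex.I • α y) := by
    funext y
    change _ = (h y).re • α y + (h y).im • (Complex.I • α y)
    conv_lhs => rw [← Complex.re_add_im (h y), add_smul, mul_smul]
    simp
  rw [hsplit, a.isCovariantDerivativeOnUniv.add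
      (hre.mdifferentiableAt.smul_section hα') (him.mdifferentiableAt.smul_section hIα'),
    a.isCovariantDerivativeOnUniv.leibniz hα' hre.mdifferentiableAt,
    a.isCovariantDerivativeOnUniv.leibniz hIα' him.mdifferentiableAt]
  have e1 : mvfderiv (𝓡 (2 * n)) (fun y ↦ (h y).re) x v = (mvfderiv (𝓡 (2 * n)) h x v).re :=
    congrArg (fun T ↦ T v) hre.mfderiv
  have e2 : mvfderiv (𝓡 (2 * n)) (fun y ↦ (h y).im) x v = (mvfderiv (𝓡 (2 * n)) h x v).im :=
    congrArg (fun T ↦ T v) him.mfderiv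
  change (h x).re • a α x v + mvfderiv (𝓡 (2 * n)) (fun y ↦ (h y).re) x v • α x
    + ((h x).im • a (fun y ↦ Complex.I • α y) x v
      + mvfderiv (𝓡 (2 * n)) (fun y ↦ (h y).im) x v • (Complex.I • α x)) = _
  rw [e1, e2, ha α hα]
  conv_rhs => rw [← Complex.re_add_im (h x), ← Complex.re_add_im (mvfderiv (𝓡 (2 * n)) h x v)]
  simp only [add_smul, mul_smul, Complex.coe_smul]
  abel

variable [ContMDiffVectorBundle ∞ ℂ L (𝓡 (2 * n))]

section Along

variable {E' : Type*} [NormedAddCommGroup E'] [NormedSpace ℝ E'] {H' : Type*} [TopologicalSpace H']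
  {J : ModelWithCorners ℝ E' H'} {P : Type*} [TopologicalSpace P] [ChartedSpace H' P]

/-- The covariant derivative of a smooth section in the direction of a smooth vector field along a
map is a smooth section along that map. -/
lemma contMDiffWithinAt_covariantDerivative_along
    (ha : CovariantDerivative.ContMDiffCovariantDerivative a ∞) (hα : IsSmoothSection n α)
    {f : P → M} {V : ∀ p, TangentSpace (𝓡 (2 * n)) (f p)} {s : Set P} {p : P}
    (hV : ContMDiffWithinAt J (𝓡 (2 * n)).tangent ∞
      (fun p ↦ (⟨f p, V p⟩ : TangentBundle (𝓡 (2 * n)) M)) s p) :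
    ContMDiffWithinAt J ((𝓡 (2 * n)).prod 𝓘(ℝ, ℂ)) ∞
      (fun p ↦ (⟨f p, a α (f p) (V p)⟩ : TotalSpace ℂ L)) s p := by
  have h1 := ha.contMDiff.contMDiff (σ := α) (ContMDiff.contMDiffOn hα)
  have hf : ContMDiffWithinAt J (𝓡 (2 * n)) ∞ f s p := (contMDiffWithinAt_totalSpace.1 hV).1
  exact ContMDiffWithinAt.clm_bundle_apply
    (((contMDiffOn_univ.1 h1) (f p)).comp_contMDiffWithinAt p hf) hV

lemma contMDiffWithinAt_rho_along
    (ha : CovariantDerivative.ContMDiffCovariantDerivative a ∞) (hα : IsSmoothSection n α)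
    {f : P → M} {V : ∀ p, TangentSpace (𝓡 (2 * n)) (f p)} {s : Set P} {p : P}
    (hV : ContMDiffWithinAt J (𝓡 (2 * n)).tangent ∞
      (fun p ↦ (⟨f p, V p⟩ : TangentBundle (𝓡 (2 * n)) M)) s p) (hp : α (f p) ≠ 0) :
    ContMDiffWithinAt J 𝓘(ℝ, ℂ) ∞ (fun p ↦ rho a α (f p) (V p)) s p := by
  have hf : ContMDiffWithinAt J (𝓡 (2 * n)) ∞ f s p := (contMDiffWithinAt_totalSpace.1 hV).1
  have h1 := (contMDiffWithinAt_totalSpace.1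
    (contMDiffWithinAt_covariantDerivative_along ha hα hV)).2
  have h2 := (contMDiffWithinAt_totalSpace.1 ((hα (f p)).comp_contMDiffWithinAt p hf)).2
  -- in a local trivialization, `ρ` is the quotient of the coordinates of `∇α` and `α`
  have hpb := mem_baseSet_trivializationAt ℂ L (f p)
  have hne := mt (trivializationAt_snd_eq_zero_iff (f p) hpb _).1 hp
  have hinv : ContMDiffWithinAt J 𝓘(ℝ, ℂ) ∞
      (fun p' ↦ ((trivializationAt ℂ L (f p) ⟨f p', α (f p')⟩).2)⁻¹) s p :=
    ((contDiffAt_inv ℝ hne).contMDiffAt.comp_contMDiffWithinAt p h2)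
  have hmul := (contDiff_mul (𝕜 := ℝ) (𝔸 := ℂ) (n := ∞)).contMDiff.contMDiffAt
    |>.comp_contMDiffWithinAt p (h1.prodMk_space hinv)
  have key : ∀ x, (x ∈ (trivializationAt ℂ L (f p)).baseSet ∧ α x ≠ 0) → ∀ v, rho a α x v =
      (trivializationAt ℂ L (f p) ⟨x, a α x v⟩).2 *
        ((trivializationAt ℂ L (f p) ⟨x, α x⟩).2)⁻¹ := by
    rintro x ⟨hx, hαx⟩ v
    have h3 : (trivializationAt ℂ L (f p) ⟨x, rho a α x v • α x⟩).2 =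
        rho a α x v * (trivializationAt ℂ L (f p) ⟨x, α x⟩).2 :=
      ((trivializationAt ℂ L (f p)).continuousLinearEquivAt ℂ x hx).map_smul _ _
    rw [rho_smul_eq v hαx] at h3
    rw [h3, mul_inv_cancel_right₀ (mt (trivializationAt_snd_eq_zero_iff (f p) hx _).1 hαx)]
  refine hmul.congr_of_eventuallyEq ?_ (key _ ⟨hpb, hp⟩ _)
  filter_upwards [hf.continuousWithinAt.eventually (eventually_trivializationAt_ne_zero hα hp)]
    with p' hp'
  exact key _ hp' _

end Along

section AlongNormedSpace

variable {E' : Type*} [NormedAddCommGroup E'] [NormedSpace ℝ E'] {s : Set E'} {f : E' → M}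

/-- The velocity of a smooth map in a fixed direction is a smooth vector field along the map. -/
lemma contMDiffOn_mfderivWithin_apply (hs : UniqueDiffOn ℝ s)
    (hf : ContMDiffOn 𝓘(ℝ, E') (𝓡 (2 * n)) ∞ f s) (w : E') :
    ContMDiffOn 𝓘(ℝ, E') (𝓡 (2 * n)).tangent ∞ (fun z ↦ (⟨f z,
      mfderivWithin 𝓘(ℝ, E') (𝓡 (2 * n)) f s z w⟩ : TangentBundle (𝓡 (2 * n)) M)) s := by
  have h1 := hf.contMDiffOn_tangentMapWithin (m := ∞) le_rfl hs.uniqueMDiffOn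
  have h2 : ContMDiffOn 𝓘(ℝ, E') 𝓘(ℝ, E').tangent ∞
      (fun z ↦ (⟨z, w⟩ : TangentBundle 𝓘(ℝ, E') E')) s :=
    contMDiffOn_vectorSpace_iff_contDiffOn.2 contDiffOn_const
  exact h1.comp h2 fun z hz ↦ hz

lemma contDiffOn_rho_mfderivWithin
    (ha : CovariantDerivative.ContMDiffCovariantDerivative a ∞) (hα : IsSmoothSection n α)
    (hs : UniqueDiffOn ℝ s) (hf : ContMDiffOn 𝓘(ℝ, E') (𝓡 (2 * n)) ∞ f s)
    (hD : ∀ z ∈ s, α (f z) ≠ 0) (w : E') :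
    ContDiffOn ℝ ∞ (fun z ↦ rho a α (f z) (mfderivWithin 𝓘(ℝ, E') (𝓡 (2 * n)) f s z w)) s :=
  fun z hz ↦ (contMDiffWithinAt_rho_along ha hα
    (contMDiffOn_mfderivWithin_apply hs hf w z hz) (hD z hz)).contDiffWithinAt

end AlongNormedSpace

end ConnectionForm

/-! ### Coordinate vector fields -/

section CoordinateFields

variable {n : ℕ} {M : Type u} [TopologicalSpace M] [T2Space M]
  [ChartedSpace (EuclideanSpace ℝ (Fin (2 * n))) M] [IsManifold (𝓡 (2 * n)) ∞ M]

lemma eventually_mfderiv_extChartAt_symm_comp (p : M) :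
    ∀ᶠ q in 𝓝 (extChartAt (𝓡 (2 * n)) p p),
      (extChartAt (𝓡 (2 * n)) p).symm q ∈ (extChartAt (𝓡 (2 * n)) p).source ∧
      extChartAt (𝓡 (2 * n)) p ((extChartAt (𝓡 (2 * n)) p).symm q) = q ∧
      (mfderiv 𝓘(ℝ, EuclideanSpace ℝ (Fin (2 * n))) (𝓡 (2 * n))
        (extChartAt (𝓡 (2 * n)) p).symm q).IsInvertible := by
  filter_upwards [(isOpen_extChartAt_target (I := 𝓡 (2 * n)) p).mem_nhds
    (mem_extChartAt_target (I := 𝓡 (2 * n)) p)] with q hq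
  refine ⟨(extChartAt (𝓡 (2 * n)) p).map_target hq, (extChartAt (𝓡 (2 * n)) p).right_inv hq, ?_⟩
  have := isInvertible_mfderivWithin_extChartAt_symm (I := 𝓡 (2 * n)) hq
  rwa [ModelWithCorners.range_eq_univ, mfderivWithin_univ] at this

/-- Coordinate vector fields extend from a neighbourhood of a point to global smooth fields. -/
lemma exists_smoothField_eventuallyEq_coordinate (p : M) (u : EuclideanSpace ℝ (Fin (2 * n))) :
    ∃ X : ∀ x : M, TangentSpace (𝓡 (2 * n)) x, IsSmoothField X ∧
      ∀ᶠ x in 𝓝 p, X x = mfderiv 𝓘(ℝ, EuclideanSpace ℝ (Fin (2 * n))) (𝓡 (2 * n))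
        (extChartAt (𝓡 (2 * n)) p).symm (extChartAt (𝓡 (2 * n)) p x) u := by
  set χ := extChartAt (𝓡 (2 * n)) p
  let Y : ∀ x : M, TangentSpace (𝓡 (2 * n)) x := fun x ↦
    mfderiv 𝓘(ℝ, EuclideanSpace ℝ (Fin (2 * n))) (𝓡 (2 * n)) χ.symm (χ x) u
  have hopen : IsOpen χ.target := isOpen_extChartAt_target p
  have h1 : ContMDiffOn 𝓘(ℝ, EuclideanSpace ℝ (Fin (2 * n))) (𝓡 (2 * n)).tangent ∞
      (fun q ↦ (⟨χ.symm q, mfderivWithin 𝓘(ℝ, EuclideanSpace ℝ (Fin (2 * n))) (𝓡 (2 * n))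
        χ.symm χ.target q u⟩ : TangentBundle (𝓡 (2 * n)) M)) χ.target :=
    contMDiffOn_mfderivWithin_apply hopen.uniqueDiffOn (contMDiffOn_extChartAt_symm p) u
  have h2 : ContMDiffOn (𝓡 (2 * n)) (𝓡 (2 * n)).tangent ∞
      (fun x ↦ (⟨x, Y x⟩ : TangentBundle (𝓡 (2 * n)) M)) χ.source := by
    have h3 : ContMDiffOn (𝓡 (2 * n)) 𝓘(ℝ, EuclideanSpace ℝ (Fin (2 * n))) ∞ χ χ.source := by
      rw [extChartAt_source]
      exact contMDiffOn_extChartAt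
    refine (h1.comp h3 fun x hx ↦ χ.map_source hx).congr fun x hx ↦ ?_
    have h4 : mfderivWithin 𝓘(ℝ, EuclideanSpace ℝ (Fin (2 * n))) (𝓡 (2 * n))
        χ.symm χ.target (χ x) = mfderiv 𝓘(ℝ, EuclideanSpace ℝ (Fin (2 * n))) (𝓡 (2 * n))
        χ.symm (χ x) := mfderivWithin_of_isOpen hopen (χ.map_source hx)
    have h5 : (⟨x, Y x⟩ : TangentBundle (𝓡 (2 * n)) M) = ⟨χ.symm (χ x), Y x⟩ :=
      congrArg (fun y ↦ (⟨y, (Y x : EuclideanSpace ℝ (Fin (2 * n)))⟩ : TangentBundle (𝓡 (2 * n)) M))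
        (χ.left_inv hx).symm
    rw [h5, Function.comp_apply, h4]
  obtain ⟨b⟩ : Nonempty (SmoothBumpFunction (𝓡 (2 * n)) p) := inferInstance
  refine ⟨(b : M → ℝ) • Y, ?_, ?_⟩
  · exact ContMDiffOn.smul_section_of_tsupport b.contMDiff.contMDiffOn
      (isOpen_extChartAt_source p) b.tsupport_subset_extChartAt_source h2
  · filter_upwards [b.eventuallyEq_one] with x hx
    change b x • Y x = _
    rw [hx, Pi.one_apply, one_smul]

lemma mlieBracket_eq_zero_of_coordinate {p : M} {u u' : EuclideanSpace ℝ (Fin (2 * n))}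
    {X X' : ∀ x : M, TangentSpace (𝓡 (2 * n)) x}
    (hX : ∀ᶠ x in 𝓝 p, X x = mfderiv 𝓘(ℝ, EuclideanSpace ℝ (Fin (2 * n))) (𝓡 (2 * n))
        (extChartAt (𝓡 (2 * n)) p).symm (extChartAt (𝓡 (2 * n)) p x) u)
    (hX' : ∀ᶠ x in 𝓝 p, X' x = mfderiv 𝓘(ℝ, EuclideanSpace ℝ (Fin (2 * n))) (𝓡 (2 * n))
        (extChartAt (𝓡 (2 * n)) p).symm (extChartAt (𝓡 (2 * n)) p x) u') :
    VectorField.mlieBracket (𝓡 (2 * n)) X X' p = 0 := by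
  have key : ∀ (u : EuclideanSpace ℝ (Fin (2 * n))) (X : ∀ x : M, TangentSpace (𝓡 (2 * n)) x),
      (∀ᶠ x in 𝓝 p, X x = mfderiv 𝓘(ℝ, EuclideanSpace ℝ (Fin (2 * n))) (𝓡 (2 * n))
        (extChartAt (𝓡 (2 * n)) p).symm (extChartAt (𝓡 (2 * n)) p x) u) →
      VectorField.mpullbackWithin 𝓘(ℝ, EuclideanSpace ℝ (Fin (2 * n))) (𝓡 (2 * n))
        (extChartAt (𝓡 (2 * n)) p).symm X (range (𝓡 (2 * n)))
        =ᶠ[𝓝 (extChartAt (𝓡 (2 * n)) p p)] fun _ ↦ u := by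
    intro u X hX
    have hc : Tendsto (extChartAt (𝓡 (2 * n)) p).symm (𝓝 (extChartAt (𝓡 (2 * n)) p p)) (𝓝 p) := by
      simpa using (continuousAt_extChartAt_symm (I := 𝓡 (2 * n)) p).tendsto
    filter_upwards [hc.eventually hX, eventually_mfderiv_extChartAt_symm_comp p]
      with q hq ⟨_, hq2, hq3⟩
    rw [VectorField.mpullbackWithin_apply, hq, ModelWithCorners.range_eq_univ, mfderivWithin_univ,
      hq2]
    obtain ⟨e, he⟩ := hq3
    rw [← he, ContinuousLinearMap.inverse_equiv]
    exact e.symm_apply_apply u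
  have hmem : extChartAt (𝓡 (2 * n)) p p ∈
      (extChartAt (𝓡 (2 * n)) p).symm ⁻¹' univ ∩ range (𝓡 (2 * n)) := by simp
  have h0 := Filter.EventuallyEq.lieBracketWithin_vectorField_eq_of_mem (𝕜 := ℝ)
    ((key u X hX).filter_mono nhdsWithin_le_nhds) ((key u' X' hX').filter_mono nhdsWithin_le_nhds)
    hmem
  rw [← VectorField.mlieBracketWithin_univ, VectorField.mlieBracketWithin_apply]
  refine (congrArg _ (h0.trans ?_)).trans (map_zero _)
  simp only [VectorField.lieBracketWithin_eq, fderivWithin_fun_const, Pi.zero_apply,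
    zero_apply, sub_self]
  rfl

end CoordinateFields

/-! ### The structure equation `dρ = 2πiΩ`, pulled back by a map from a vector space -/

section Curvature

/-- The exterior derivative of a 1-form commutes with the pullback by a `C²` map; the second
derivatives of the map cancel by symmetry. -/
lemma fderiv_pullback_sub_swap {E E' F : Type*} [NormedAddCommGroup E] [NormedSpace ℝ E]
    [NormedAddCommGroup E'] [NormedSpace ℝ E'] [NormedAddCommGroup F] [NormedSpace ℝ F]
    {η : E → E →L[ℝ] F} {f : E' → E} {z : E'} (hη : DifferentiableAt ℝ η (f z))
    (hf : ContDiffAt ℝ 2 f z) (v w : E') :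
    fderiv ℝ (fun y ↦ η (f y) (fderiv ℝ f y w)) z v
        - fderiv ℝ (fun y ↦ η (f y) (fderiv ℝ f y v)) z w
      = fderiv ℝ η (f z) (fderiv ℝ f z v) (fderiv ℝ f z w)
        - fderiv ℝ η (f z) (fderiv ℝ f z w) (fderiv ℝ f z v) := by
  have hf1 : DifferentiableAt ℝ f z := hf.differentiableAt (by norm_num)
  have hf2 : DifferentiableAt ℝ (fderiv ℝ f) z :=
    (hf.fderiv_right (m := 1) (by norm_num)).differentiableAt (by norm_num)
  have hsymm : IsSymmSndFDerivAt ℝ f z := hf.isSymmSndFDerivAt (by simp)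
  have key : ∀ v w, fderiv ℝ (fun y ↦ η (f y) (fderiv ℝ f y w)) z v =
      fderiv ℝ η (f z) (fderiv ℝ f z v) (fderiv ℝ f z w)
        + η (f z) (fderiv ℝ (fderiv ℝ f) z v w) := by
    intro v w
    have h1 : HasFDerivAt (fun y ↦ η (f y)) ((fderiv ℝ η (f z)).comp (fderiv ℝ f z)) z :=
      hη.hasFDerivAt.comp z hf1.hasFDerivAt
    have h2 : HasFDerivAt (fun y ↦ fderiv ℝ f y w) _ z :=
      hf2.hasFDerivAt.clm_apply (hasFDerivAt_const w z)
    rw [(h1.clm_apply h2).fderiv]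
    simp [add_comm]
  rw [key v w, key w v, hsymm v w]
  abel

variable {n : ℕ} {M : Type u} [TopologicalSpace M] [T2Space M]
  [ChartedSpace (EuclideanSpace ℝ (Fin (2 * n))) M] [IsManifold (𝓡 (2 * n)) ∞ M]
  {L : M → Type v} [TopologicalSpace (TotalSpace ℂ L)]
  [∀ x, NormedAddCommGroup (L x)] [∀ x, InnerProductSpace ℂ (L x)]
  [FiberBundle ℂ L] [VectorBundle ℂ ℂ L] [VectorBundle ℝ ℂ L]
  [ContMDiffVectorBundle ∞ ℂ L (𝓡 (2 * n))] {Ω : SymplecticForm n M}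
  {a : CovariantDerivative (𝓡 (2 * n)) ℂ L} {α : ∀ x, L x}

/-- The curvature identity for two commuting fields, in terms of the connection form. -/
lemma mvfderiv_rho_sub_swap (ha : IsPrequantum Ω a) (hα : IsSmoothSection n α) {p : M}
    (hp : α p ≠ 0) {X Y : ∀ x : M, TangentSpace (𝓡 (2 * n)) x} (hX : IsSmoothField X)
    (hY : IsSmoothField Y) (hXY : VectorField.mlieBracket (𝓡 (2 * n)) X Y p = 0) :
    mvfderiv (𝓡 (2 * n)) (fun y ↦ rho a α y (Y y)) p (X p)
        - mvfderiv (𝓡 (2 * n)) (fun y ↦ rho a α y (X y)) p (Y p)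
      = 2 * Real.pi * Ω.toFun p (X p) (Y p) * Complex.I := by
  have key : ∀ X Y : (∀ x : M, TangentSpace (𝓡 (2 * n)) x), IsSmoothField Y →
      a (fun y ↦ a α y (Y y)) p (X p) =
        (rho a α p (Y p) * rho a α p (X p) +
          mvfderiv (𝓡 (2 * n)) (fun y ↦ rho a α y (Y y)) p (X p)) • α p := by
    intro X Y hY
    have hr : MDifferentiableAt (𝓡 (2 * n)) 𝓘(ℝ, ℂ) (fun y ↦ rho a α y (Y y)) p :=
      (contMDiffWithinAt_rho_along (f := id) ha.smooth hα (hY p) hp).contMDiffAt univ_mem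
        |>.mdifferentiableAt (by simp)
    have hs1 : MDifferentiableAt (𝓡 (2 * n)) ((𝓡 (2 * n)).prod 𝓘(ℝ, ℂ))
        (fun y ↦ (⟨y, a α y (Y y)⟩ : TotalSpace ℂ L)) p :=
      (contMDiffWithinAt_covariantDerivative_along (f := id) ha.smooth hα (hY p)).contMDiffAt
        univ_mem |>.mdifferentiableAt (by simp)
    have heq : ∀ᶠ y in 𝓝 p, a α y (Y y) = rho a α y (Y y) • α y := by
      filter_upwards [eventually_trivializationAt_ne_zero hα hp] with y hy
      exact (rho_smul_eq _ hy.2).symm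
    have hs2 : MDifferentiableAt (𝓡 (2 * n)) ((𝓡 (2 * n)).prod 𝓘(ℝ, ℂ))
        (fun y ↦ (⟨y, rho a α y (Y y) • α y⟩ : TotalSpace ℂ L)) p :=
      hs1.congr_of_eventuallyEq (heq.mono fun y hy ↦ by simp only [hy])
    rw [a.isCovariantDerivativeOnUniv.congr_of_eventuallyEq hs1 hs2 univ_mem heq,
      leibniz_complex ha.complexLinear hα hr, add_smul, mul_smul, rho_smul_eq _ hp]
  have hc := ha.curvature X Y α hX hY hα p
  rw [key X Y hY, key Y X hX, hXY, map_zero, sub_zero, ← sub_smul] at hc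
  have := smul_left_injective ℂ hp hc
  rw [← this]
  ring

variable (a α) in
/-- The connection form `ρ(α)` in the chart at `p`: a 1-form on (the target of the chart in) the
model space. -/
noncomputable def rhoInChart (p : M) (q : EuclideanSpace ℝ (Fin (2 * n))) :
    EuclideanSpace ℝ (Fin (2 * n)) →L[ℝ] ℂ :=
  (rhoCLM a α ((extChartAt (𝓡 (2 * n)) p).symm q)).comp
    (mfderiv 𝓘(ℝ, EuclideanSpace ℝ (Fin (2 * n))) (𝓡 (2 * n)) (extChartAt (𝓡 (2 * n)) p).symm q)

lemma rhoInChart_apply (p : M) (q u : EuclideanSpace ℝ (Fin (2 * n))) :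
    rhoInChart a α p q u = rho a α ((extChartAt (𝓡 (2 * n)) p).symm q)
      (mfderiv 𝓘(ℝ, EuclideanSpace ℝ (Fin (2 * n))) (𝓡 (2 * n))
        (extChartAt (𝓡 (2 * n)) p).symm q u) := by
  rw [← rhoCLM_apply]
  rfl

lemma differentiableAt_rhoInChart (ha : CovariantDerivative.ContMDiffCovariantDerivative a ∞)
    (hα : IsSmoothSection n α) {p : M} (hp : α p ≠ 0) :
    DifferentiableAt ℝ (rhoInChart a α p) (extChartAt (𝓡 (2 * n)) p p) := by
  set χ := extChartAt (𝓡 (2 * n)) p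
  obtain ⟨U, hU, hUo, hpU⟩ := eventually_nhds_iff.1 (eventually_trivializationAt_ne_zero hα hp)
  set T : Set (EuclideanSpace ℝ (Fin (2 * n))) := χ.target ∩ χ.symm ⁻¹' U
  have hT : IsOpen T := (continuousOn_extChartAt_symm p).isOpen_inter_preimage
    (isOpen_extChartAt_target p) hUo
  have hpT : χ p ∈ T := ⟨mem_extChartAt_target p, by simpa [χ] using hpU⟩
  have h1 : ContDiffOn ℝ ∞ (rhoInChart a α p) T := by
    rw [contDiffOn_clm_apply]
    intro u
    refine (contDiffOn_rho_mfderivWithin ha hα hT.uniqueDiffOn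
      ((contMDiffOn_extChartAt_symm p).mono inter_subset_left)
      (fun q hq ↦ (hU _ hq.2).2) u).congr fun q hq ↦ ?_
    rw [rhoInChart_apply, mfderivWithin_of_isOpen hT hq]
  exact (h1.contDiffAt (hT.mem_nhds hpT)).differentiableAt (by simp)

lemma fderiv_rhoInChart_sub_swap (ha : IsPrequantum Ω a) (hα : IsSmoothSection n α) {p : M}
    (hp : α p ≠ 0) (u u' : EuclideanSpace ℝ (Fin (2 * n))) :
    fderiv ℝ (rhoInChart a α p) (extChartAt (𝓡 (2 * n)) p p) u u'
        - fderiv ℝ (rhoInChart a α p) (extChartAt (𝓡 (2 * n)) p p) u' u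
      = 2 * Real.pi * Ω.toFun p
        (mfderiv 𝓘(ℝ, EuclideanSpace ℝ (Fin (2 * n))) (𝓡 (2 * n))
          (extChartAt (𝓡 (2 * n)) p).symm (extChartAt (𝓡 (2 * n)) p p) u)
        (mfderiv 𝓘(ℝ, EuclideanSpace ℝ (Fin (2 * n))) (𝓡 (2 * n))
          (extChartAt (𝓡 (2 * n)) p).symm (extChartAt (𝓡 (2 * n)) p p) u') * Complex.I := by
  obtain ⟨X, hX, hXe⟩ := exists_smoothField_eventuallyEq_coordinate p u
  obtain ⟨X', hX', hXe'⟩ := exists_smoothField_eventuallyEq_coordinate p u'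
  have hmain := mvfderiv_rho_sub_swap ha hα hp hX hX' (mlieBracket_eq_zero_of_coordinate hXe hXe')
  have key : ∀ (u u' : EuclideanSpace ℝ (Fin (2 * n)))
      (X X' : ∀ x : M, TangentSpace (𝓡 (2 * n)) x),
      (∀ᶠ x in 𝓝 p, X x = mfderiv 𝓘(ℝ, EuclideanSpace ℝ (Fin (2 * n))) (𝓡 (2 * n))
        (extChartAt (𝓡 (2 * n)) p).symm (extChartAt (𝓡 (2 * n)) p x) u) →
      (∀ᶠ x in 𝓝 p, X' x = mfderiv 𝓘(ℝ, EuclideanSpace ℝ (Fin (2 * n))) (𝓡 (2 * n))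
        (extChartAt (𝓡 (2 * n)) p).symm (extChartAt (𝓡 (2 * n)) p x) u') →
      mvfderiv (𝓡 (2 * n)) (fun y ↦ rho a α y (X' y)) p (X p) =
        fderiv ℝ (rhoInChart a α p) (extChartAt (𝓡 (2 * n)) p p) u u' := by
    intro u u' X X' hX hX'
    have hd := (differentiableAt_rhoInChart ha.smooth hα hp).hasFDerivAt.clm_apply
      (hasFDerivAt_const u' _)
    have hχ := (mdifferentiableAt_extChartAt (I := 𝓡 (2 * n)) (mem_chart_source _ p)).hasMFDerivAt
    have hcomp := hd.hasMFDerivAt.comp p hχ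
    have heq : (fun y ↦ rho a α y (X' y)) =ᶠ[𝓝 p]
        (fun q ↦ rhoInChart a α p q u') ∘ extChartAt (𝓡 (2 * n)) p := by
      filter_upwards [hX', extChartAt_source_mem_nhds (I := 𝓡 (2 * n)) p] with y hy hys
      rw [Function.comp_apply, rhoInChart_apply, hy]
      exact congrArg (fun x : M ↦ rho a α x
        (mfderiv 𝓘(ℝ, EuclideanSpace ℝ (Fin (2 * n))) (𝓡 (2 * n)) (extChartAt (𝓡 (2 * n)) p).symm
          (extChartAt (𝓡 (2 * n)) p y) u' : EuclideanSpace ℝ (Fin (2 * n))))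
        ((extChartAt (𝓡 (2 * n)) p).left_inv hys).symm
    have hfin := (hcomp.congr_of_eventuallyEq heq).mfderiv
    have : mvfderiv (𝓡 (2 * n)) (fun y ↦ rho a α y (X' y)) p (X p) =
        fderiv ℝ (rhoInChart a α p) (extChartAt (𝓡 (2 * n)) p p)
          (mfderiv (𝓡 (2 * n)) 𝓘(ℝ, EuclideanSpace ℝ (Fin (2 * n)))
            (extChartAt (𝓡 (2 * n)) p) p (X p)) u' := by
      refine (congrArg (fun T ↦ T (X p)) hfin).trans ?_
      rw [ContinuousLinearMap.comp_zero, zero_add]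
      rfl
    rw [this, hX.self_of_nhds]
    congr 2
    have h5 := mfderiv_extChartAt_comp_mfderivWithin_extChartAt_symm' (I := 𝓡 (2 * n))
      (mem_extChartAt_source p)
    rw [ModelWithCorners.range_eq_univ, mfderivWithin_univ] at h5
    exact congrArg (fun T ↦ T u) h5
  rw [key u u' X X' hXe hXe', key u' u X' X hXe' hXe] at hmain
  rw [hmain, hXe.self_of_nhds, hXe'.self_of_nhds]

/-- The identity `dρ = 2πiΩ`, pulled back by a smooth map `f` from a vector space to the complement
of the zero set. -/
theorem fderiv_rho_mfderiv_sub_swap (ha : IsPrequantum Ω a) (hα : IsSmoothSection n α)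
    {E' : Type*} [NormedAddCommGroup E'] [NormedSpace ℝ E'] {f : E' → M} {z : E'}
    (hf : ContMDiffAt 𝓘(ℝ, E') (𝓡 (2 * n)) ∞ f z) (hp : α (f z) ≠ 0) (v w : E') :
    fderiv ℝ (fun y ↦ rho a α (f y) (mfderiv 𝓘(ℝ, E') (𝓡 (2 * n)) f y w)) z v
        - fderiv ℝ (fun y ↦ rho a α (f y) (mfderiv 𝓘(ℝ, E') (𝓡 (2 * n)) f y v)) z w
      = 2 * Real.pi * Ω.toFun (f z) (mfderiv 𝓘(ℝ, E') (𝓡 (2 * n)) f z v)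
          (mfderiv 𝓘(ℝ, E') (𝓡 (2 * n)) f z w) * Complex.I := by
  set χ := extChartAt (𝓡 (2 * n)) (f z)
  set fc : E' → EuclideanSpace ℝ (Fin (2 * n)) := fun y ↦ χ (f y)
  have hfc : ContDiffAt ℝ ∞ fc z :=
    ((contMDiffAt_extChartAt (I := 𝓡 (2 * n)) (x := f z)).comp z hf).contDiffAt
  have hsrc : ∀ᶠ y in 𝓝 z, f y ∈ χ.source :=
    hf.continuousAt.eventually (extChartAt_source_mem_nhds (I := 𝓡 (2 * n)) (f z))
  have hf' : ∀ᶠ y in 𝓝 z, mfderiv 𝓘(ℝ, E') (𝓡 (2 * n)) f y =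
      (mfderiv 𝓘(ℝ, EuclideanSpace ℝ (Fin (2 * n))) (𝓡 (2 * n)) χ.symm (fc y)).comp
        (fderiv ℝ fc y) := by
    filter_upwards [hsrc.eventually_nhds,
      (hfc.of_le (m := 1) (by simp)).eventually (by simp)] with y hy hy'
    have h1 : HasMFDerivAt 𝓘(ℝ, E') 𝓘(ℝ, EuclideanSpace ℝ (Fin (2 * n))) fc y (fderiv ℝ fc y) :=
      (hy'.differentiableAt (by simp)).hasFDerivAt.hasMFDerivAt
    have h2 : MDifferentiableAt 𝓘(ℝ, EuclideanSpace ℝ (Fin (2 * n))) (𝓡 (2 * n)) χ.symm (fc y) :=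
      ((contMDiffOn_extChartAt_symm (n := ∞) (f z)).contMDiffAt
        ((isOpen_extChartAt_target (f z)).mem_nhds
          (χ.map_source hy.self_of_nhds))).mdifferentiableAt (by simp)
    refine ((h2.hasMFDerivAt.comp y h1).congr_of_eventuallyEq ?_).mfderiv
    filter_upwards [hy] with y' hy'
    exact (χ.left_inv hy').symm
  have key : ∀ w : E', (fun y ↦ rho a α (f y) (mfderiv 𝓘(ℝ, E') (𝓡 (2 * n)) f y w)) =ᶠ[𝓝 z]
      fun y ↦ rhoInChart a α (f z) (fc y) (fderiv ℝ fc y w) := by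
    intro w
    filter_upwards [hf', hsrc] with y hy hys
    rw [rhoInChart_apply, hy]
    exact congrArg (fun x : M ↦ rho a α x
      (mfderiv 𝓘(ℝ, EuclideanSpace ℝ (Fin (2 * n))) (𝓡 (2 * n)) χ.symm (fc y) (fderiv ℝ fc y w) :
        EuclideanSpace ℝ (Fin (2 * n)))) (χ.left_inv hys).symm
  have hd : DifferentiableAt ℝ (rhoInChart a α (f z)) (fc z) :=
    differentiableAt_rhoInChart ha.smooth hα hp
  rw [(key w).fderiv_eq, (key v).fderiv_eq,
    fderiv_pullback_sub_swap hd (hfc.of_le (by norm_cast)),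
    fderiv_rhoInChart_sub_swap ha hα hp, hf'.self_of_nhds]
  rfl

end Curvature

/-! ### Transport of the imaginary part of the connection form along a Hamiltonian flow -/

section Transport

variable {n : ℕ} {M : Type u} [TopologicalSpace M] [T2Space M]
  [ChartedSpace (EuclideanSpace ℝ (Fin (2 * n))) M] [IsManifold (𝓡 (2 * n)) ∞ M]
  {L : M → Type v} [TopologicalSpace (TotalSpace ℂ L)]
  [∀ x, NormedAddCommGroup (L x)] [∀ x, InnerProductSpace ℂ (L x)]
  [FiberBundle ℂ L] [VectorBundle ℂ ℂ L] [VectorBundle ℝ ℂ L]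
  [ContMDiffVectorBundle ∞ ℂ L (𝓡 (2 * n))] {Ω : SymplecticForm n M}
  {a : CovariantDerivative (𝓡 (2 * n)) ℂ L} {α : ∀ x, L x}
  {E' : Type} [NormedAddCommGroup E'] [NormedSpace ℝ E'] [FiniteDimensional ℝ E'] {T : Set E'}

variable (a α T) in
/-- The time derivative `Im ρ(∂ₜf) + 2πh` of the phase picked up along the family `f`, where `h` is
the Hamiltonian along `f`. -/
noncomputable def phaseSpeed (f : ℝ × E' → M) (h : ℝ × E' → ℝ) (q : ℝ × E') : ℝ :=
  (rho a α (f q) (mfderivWithin 𝓘(ℝ, ℝ × E') (𝓡 (2 * n)) f (Icc (0 : ℝ) 1 ×ˢ T) q (1, 0))).im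
    + 2 * Real.pi * h q

lemma contDiffOn_phaseSpeed (ha : CovariantDerivative.ContMDiffCovariantDerivative a ∞)
    (hα : IsSmoothSection n α) (hT : IsOpen T)
    {f : ℝ × E' → M} (hf : ContMDiffOn 𝓘(ℝ, ℝ × E') (𝓡 (2 * n)) ∞ f (Icc (0 : ℝ) 1 ×ˢ T))
    (hD : ∀ q ∈ Icc (0 : ℝ) 1 ×ˢ T, α (f q) ≠ 0)
    {h : ℝ × E' → ℝ} (hh : ContDiffOn ℝ ∞ h (Icc (0 : ℝ) 1 ×ˢ T)) :
    ContDiffOn ℝ ∞ (phaseSpeed a α T f h) (Icc (0 : ℝ) 1 ×ˢ T) :=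
  (Complex.imCLM.contDiff.comp_contDiffOn (contDiffOn_rho_mfderivWithin ha hα
    ((uniqueDiffOn_Icc zero_lt_one).prod hT.uniqueDiffOn) hf hD (1, 0))).add
    (contDiffOn_const.mul hh)

/-- If `f` moves with a Hamiltonian flow and `Im ρ` vanishes along `f (0, ·)`, then along `f (t, ·)`
the form `Im ρ` is the differential of the accumulated phase. This is Cartan's formula for the
time derivative of the pullback of `Im ρ`, integrated over time. -/
theorem im_rho_eq_fderivWithin_primitive (ha : IsPrequantum Ω a) (hα : IsSmoothSection n α)
    (hT : IsOpen T)
    {f : ℝ × E' → M} (hf : ContMDiffOn 𝓘(ℝ, ℝ × E') (𝓡 (2 * n)) ∞ f (Icc (0 : ℝ) 1 ×ˢ T))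
    (hD : ∀ q ∈ Icc (0 : ℝ) 1 ×ˢ T, α (f q) ≠ 0)
    {h : ℝ × E' → ℝ} (hh : ContDiffOn ℝ ∞ h (Icc (0 : ℝ) 1 ×ˢ T))
    (hham : ∀ q ∈ Ioo (0 : ℝ) 1 ×ˢ T, ∀ v : E',
      Ω.toFun (f q) (mfderiv 𝓘(ℝ, ℝ × E') (𝓡 (2 * n)) f q (1, 0))
        (mfderiv 𝓘(ℝ, ℝ × E') (𝓡 (2 * n)) f q (0, v)) = fderiv ℝ h q (0, v))
    (h0 : ∀ z ∈ T, ∀ v : E', (rho a α (f (0, z)) (mfderivWithin 𝓘(ℝ, ℝ × E') (𝓡 (2 * n)) f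
      (Icc (0 : ℝ) 1 ×ˢ T) (0, z) (0, v))).im = 0)
    {t : ℝ} (ht : t ∈ Icc (0 : ℝ) 1) {z : E'} (hz : z ∈ T) (v : E') :
    (rho a α (f (t, z)) (mfderivWithin 𝓘(ℝ, ℝ × E') (𝓡 (2 * n)) f
        (Icc (0 : ℝ) 1 ×ˢ T) (t, z) (0, v))).im
      = fderivWithin ℝ (fun q : ℝ × E' ↦ ∫ s in (0 : ℝ)..q.1, phaseSpeed a α T f h (s, q.2))
        (Icc (0 : ℝ) 1 ×ˢ T) (t, z) (0, v) := by
  set W : Set (ℝ × E') := Icc (0 : ℝ) 1 ×ˢ T with hW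
  set O : Set (ℝ × E') := Ioo (0 : ℝ) 1 ×ˢ T with hO
  have hOo : IsOpen O := isOpen_Ioo.prod hT
  have hOW : O ⊆ W := prod_mono Ioo_subset_Icc_self le_rfl
  have hUW : UniqueDiffOn ℝ W := (uniqueDiffOn_Icc zero_lt_one).prod hT.uniqueDiffOn
  have hWn : ∀ q ∈ O, W ∈ 𝓝 q := fun q hq ↦ mem_of_superset (hOo.mem_nhds hq) hOW
  set k := phaseSpeed a α T f h with hk
  set g : ℝ × E' → ℝ := fun q ↦ ∫ s in (0 : ℝ)..q.1, k (s, q.2) with hg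
  have hks : ContDiffOn ℝ ∞ k W := contDiffOn_phaseSpeed ha.smooth hα hT hf hD hh
  have hgs : ContDiffOn ℝ ∞ g W := contDiffOn_primitive_param hT hks
  have hgd : ∀ q ∈ W, HasFDerivWithinAt g _ W q := fun q hq ↦
    hasFDerivWithinAt_primitive_param hT (hks.of_le (by simp)) hq
  have hr : ∀ w : ℝ × E', ContDiffOn ℝ ∞
      (fun q ↦ rho a α (f q) (mfderivWithin 𝓘(ℝ, ℝ × E') (𝓡 (2 * n)) f W q w)) W :=
    fun w ↦ contDiffOn_rho_mfderivWithin ha.smooth hα hUW hf hD w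
  set e : ℝ × E' → ℝ := fun q ↦
    (rho a α (f q) (mfderivWithin 𝓘(ℝ, ℝ × E') (𝓡 (2 * n)) f W q (0, v))).im
      - fderivWithin ℝ g W q (0, v) with he
  have hes : ContDiffOn ℝ ∞ e W := (Complex.imCLM.contDiff.comp_contDiffOn (hr (0, v))).sub
    ((hgs.fderivWithin hUW (m := ∞) le_rfl).clm_apply contDiffOn_const)
  -- the time derivative of `e` vanishes in the interior, by the structure equation
  have hder : ∀ q ∈ O, fderiv ℝ e q (1, 0) = 0 := by
    intro q hq
    have hfq : ContMDiffAt 𝓘(ℝ, ℝ × E') (𝓡 (2 * n)) ∞ f q := hf.contMDiffAt (hWn q hq)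
    have hmf : ∀ y ∈ O, mfderivWithin 𝓘(ℝ, ℝ × E') (𝓡 (2 * n)) f W y =
        mfderiv 𝓘(ℝ, ℝ × E') (𝓡 (2 * n)) f y := fun y hy ↦ mfderivWithin_of_mem_nhds (hWn y hy)
    have hrd : ∀ w : ℝ × E', DifferentiableAt ℝ
        (fun q ↦ rho a α (f q) (mfderivWithin 𝓘(ℝ, ℝ × E') (𝓡 (2 * n)) f W q w)) q :=
      fun w ↦ ((hr w).contDiffAt (hWn q hq)).differentiableAt (by simp)
    have hrim : ∀ w u : ℝ × E', fderiv ℝ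
        (fun q ↦ (rho a α (f q) (mfderivWithin 𝓘(ℝ, ℝ × E') (𝓡 (2 * n)) f W q w)).im) q u =
        (fderiv ℝ (fun q ↦ rho a α (f q) (mfderiv 𝓘(ℝ, ℝ × E') (𝓡 (2 * n)) f q w)) q u).im := by
      intro w u
      have h1 := (Complex.imCLM.hasFDerivAt.comp q (hrd w).hasFDerivAt).fderiv
      have h2 : (fun q ↦ rho a α (f q) (mfderivWithin 𝓘(ℝ, ℝ × E') (𝓡 (2 * n)) f W q w)) =ᶠ[𝓝 q]
          fun q ↦ rho a α (f q) (mfderiv 𝓘(ℝ, ℝ × E') (𝓡 (2 * n)) f q w) := by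
        filter_upwards [hOo.mem_nhds hq] with y hy
        rw [hmf y hy]
      rw [h2.fderiv_eq] at h1
      exact congrArg (fun T ↦ T u) h1
    have hgq : ContDiffAt ℝ ∞ g q := hgs.contDiffAt (hWn q hq)
    have hg2 : DifferentiableAt ℝ (fderiv ℝ g) q :=
      (hgq.fderiv_right (m := ∞) le_rfl).differentiableAt (by simp)
    have hgk : (fun y ↦ fderiv ℝ g y (1, 0)) =ᶠ[𝓝 q] k := by
      filter_upwards [hOo.mem_nhds hq] with y hy
      rw [((hgd y (hOW hy)).hasFDerivAt (hWn y hy)).fderiv]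
      simp
    have hge : (fun y ↦ fderivWithin ℝ g W y (0, v)) =ᶠ[𝓝 q] fun y ↦ fderiv ℝ g y (0, v) := by
      filter_upwards [hOo.mem_nhds hq] with y hy
      rw [fderivWithin_of_mem_nhds (hWn y hy)]
    have hsymm : IsSymmSndFDerivAt ℝ g q :=
      (hgq.of_le (m := 2) (by norm_cast)).isSymmSndFDerivAt (by simp)
    have happ : ∀ w u : ℝ × E', fderiv ℝ (fun y ↦ fderiv ℝ g y w) q u =
        fderiv ℝ (fderiv ℝ g) q u w := by
      intro w u
      rw [(hg2.hasFDerivAt.clm_apply (hasFDerivAt_const w q)).fderiv]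
      simp
    have hhd : DifferentiableAt ℝ h q := (hh.contDiffAt (hWn q hq)).differentiableAt (by simp)
    have hmix : fderiv ℝ (fun y ↦ fderivWithin ℝ g W y (0, v)) q (1, 0) =
        fderiv ℝ (fun q ↦
          (rho a α (f q) (mfderivWithin 𝓘(ℝ, ℝ × E') (𝓡 (2 * n)) f W q (1, 0))).im) q (0, v)
        + 2 * Real.pi * fderiv ℝ h q (0, v) := by
      rw [hge.fderiv_eq, happ, hsymm, ← happ, hgk.fderiv_eq]
      have h1 : HasFDerivAt k _ q := ((Complex.imCLM.hasFDerivAt.comp q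
        (hrd (1, 0)).hasFDerivAt)).add (hhd.hasFDerivAt.const_mul (2 * Real.pi))
      have h2 := (Complex.imCLM.hasFDerivAt.comp q (hrd (1, 0)).hasFDerivAt).fderiv
      rw [h1.fderiv]
      exact congrArg₂ (· + ·) (congrArg (fun T ↦ T (0, v)) h2).symm rfl
    have hcurv := congrArg Complex.im
      (fderiv_rho_mfderiv_sub_swap ha hα hfq (hD q (hOW hq)) (1, 0) (0, v))
    rw [Complex.sub_im, ← hrim, ← hrim, hham q hq] at hcurv
    have hsub : fderiv ℝ e q = fderiv ℝ (fun q ↦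
          (rho a α (f q) (mfderivWithin 𝓘(ℝ, ℝ × E') (𝓡 (2 * n)) f W q (0, v))).im) q
        - fderiv ℝ (fun y ↦ fderivWithin ℝ g W y (0, v)) q := by
      refine fderiv_fun_sub ?_ ?_
      · exact (Complex.imCLM.hasFDerivAt.comp q (hrd (0, v)).hasFDerivAt).differentiableAt
      · exact (hg2.clm_apply (differentiableAt_const _)).congr_of_eventuallyEq hge
    rw [hsub, sub_apply, hmix]
    have him : (2 * Real.pi * (fderiv ℝ h q (0, v) : ℂ) * Complex.I).im
        = 2 * Real.pi * fderiv ℝ h q (0, v) := by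
      simp
    rw [him] at hcurv
    linarith
  -- hence `e` is constant in time
  have he0 : e (0, z) = 0 := by
    have h1 : (fun z ↦ g (0, z)) = fun _ ↦ 0 := by
      funext z
      simp [hg]
    have h2 : HasFDerivWithinAt (fun z ↦ g (0, z))
        ((fderivWithin ℝ g W (0, z)).comp (ContinuousLinearMap.inr ℝ ℝ E')) T z :=
      (hgs.differentiableOn (by simp) (0, z) ⟨by simp, hz⟩).hasFDerivWithinAt.comp z
        (hasFDerivAt_prodMk_right (0 : ℝ) z).hasFDerivWithinAt fun y hy ↦ ⟨by simp, hy⟩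
    have h3 := h2.hasFDerivAt (hT.mem_nhds hz)
    rw [h1] at h3
    have h4 := congrArg (fun T ↦ T v) (h3.unique (hasFDerivAt_const 0 z))
    have h5 : fderivWithin ℝ g W (0, z) (0, v) = 0 := h4
    rw [he]
    simp only [h0 z hz v, h5, sub_zero]
  have het : e (t, z) = 0 := by
    rcases ht.1.eq_or_lt with rfl | htpos
    · exact he0
    have hcont : ContinuousOn (fun s : ℝ ↦ e (s, z)) (Icc 0 t) :=
      (continuousOn_time_slice hes.continuousOn hz).mono (Icc_subset_Icc_right ht.2)
    have hd : ∀ s ∈ Ioo (0 : ℝ) t, HasDerivAt (fun s : ℝ ↦ e (s, z)) 0 s := by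
      intro s hs
      have hsO : (s, z) ∈ O := ⟨⟨hs.1, hs.2.trans_le ht.2⟩, hz⟩
      have h1 : HasFDerivAt e (fderiv ℝ e (s, z)) (s, z) :=
        ((hes.contDiffAt (hWn _ hsO)).differentiableAt (by simp)).hasFDerivAt
      have h2 : HasDerivAt (fun s : ℝ ↦ (s, z)) ((1 : ℝ), (0 : E')) s :=
        (hasDerivAt_id s).prodMk (hasDerivAt_const s z)
      have h3 := h1.comp_hasDerivAt s h2
      rwa [hder _ hsO] at h3
    obtain ⟨s, hs, hs'⟩ := exists_hasDerivAt_eq_slope _ _ htpos hcont hd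
    have := (eq_div_iff (sub_pos.2 htpos).ne').1 hs'
    rw [he0] at this
    linarith
  exact sub_eq_zero.1 het

end Transport

/-! ### Smooth embeddings and homology classes under a smooth isotopy -/

section Isotopy

open CategoryTheory AlgebraicTopology

/-- The composition of a smooth embedding with a diffeomorphism of the target. The chart of the
target in which the embedding is linear is transported by the diffeomorphism. -/
lemma isSmoothEmbedding_diffeomorph_comp {E F H G N M : Type*}
    [NormedAddCommGroup E] [NormedSpace ℝ E] [NormedAddCommGroup F] [NormedSpace ℝ F]
    [TopologicalSpace H] [TopologicalSpace G] {I : ModelWithCorners ℝ E H}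
    {J : ModelWithCorners ℝ F G} [TopologicalSpace N] [ChartedSpace H N]
    [TopologicalSpace M] [ChartedSpace G M] [IsManifold J ∞ M] {ι : N → M}
    (hι : IsSmoothEmbedding I J ∞ ι) (φ : M ≃ₘ^∞⟮J, J⟯ M) :
    IsSmoothEmbedding I J ∞ (φ ∘ ι) := by
  refine ⟨?_, φ.toHomeomorph.isEmbedding.comp hι.isEmbedding⟩
  obtain ⟨C, instC, instC', h⟩ := hι.isImmersion
  refine ⟨C, instC, instC', fun x ↦ ?_⟩
  have hx := h x
  let ψ : OpenPartialHomeomorph M G := φ.toHomeomorph.symm.transOpenPartialHomeomorph hx.codChart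
  have hψ : ψ ∈ IsManifold.maximalAtlas J ∞ M := by
    rw [IsManifold.mem_maximalAtlas_iff_contMDiffOn]
    constructor
    · exact (contMDiffOn_of_mem_maximalAtlas hx.codChart_mem_maximalAtlas).comp
        φ.symm.contMDiff.contMDiffOn fun y hy ↦ hy
    · exact φ.contMDiff.comp_contMDiffOn
        (contMDiffOn_symm_of_mem_maximalAtlas hx.codChart_mem_maximalAtlas)
  refine IsImmersionAtOfComplement.mk_of_charts hx.equiv hx.domChart ψ hx.mem_domChart_source
    ?_ hx.domChart_mem_maximalAtlas hψ ?_ ?_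
  · change φ.symm (φ (ι x)) ∈ hx.codChart.source
    rw [φ.symm_apply_apply]
    exact hx.mem_codChart_source
  · intro y hy
    change φ.symm (φ (ι y)) ∈ hx.codChart.source
    rw [φ.symm_apply_apply]
    exact hx.source_subset_preimage_source hy
  · intro y hy
    refine Eq.trans ?_ (hx.writtenInCharts hy)
    change J (hx.codChart (φ.symm (φ (ι _)))) = J (hx.codChart (ι _))
    rw [φ.symm_apply_apply]

lemma integralHomologyMap_eq_of_homotopy {k : ℕ} {X Y : Type u} [TopologicalSpace X]
    [TopologicalSpace Y] {f g : C(X, Y)} (h : f.Homotopy g) :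
    integralHomologyMap k f = integralHomologyMap k g := by
  have h1 : TopCat.Homotopy (TopCat.ofHom f) (TopCat.ofHom g) := h
  exact congrArg ModuleCat.Hom.hom (h1.congr_homologyMap_singularChainComplexFunctor
    (ModuleCat.of ℤ (ULift.{u} ℤ)) k)

/-- A continuous family `Φ t`, `t ∈ [0, t₁]`, of maps induces the same map in homology at both
ends. -/
lemma integralHomologyMap_eq_of_continuousOn {k : ℕ} {X Y : Type u} [TopologicalSpace X]
    [TopologicalSpace Y] {Φ : ℝ × X → Y} (hΦ : ContinuousOn Φ (Icc (0 : ℝ) 1 ×ˢ univ)) {t₁ : ℝ}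
    (ht₁ : t₁ ∈ Icc (0 : ℝ) 1) {f g : C(X, Y)} (hf : ∀ x, f x = Φ (0, x))
    (hg : ∀ x, g x = Φ (t₁, x)) :
    integralHomologyMap k f = integralHomologyMap k g := by
  refine integralHomologyMap_eq_of_homotopy
    { toFun := fun q ↦ Φ (t₁ * q.1, q.2)
      continuous_toFun := ?_
      map_zero_left := fun x ↦ by simp [hf]
      map_one_left := fun x ↦ by simp [hg] }
  refine hΦ.comp_continuous (by fun_prop) fun q ↦ ⟨⟨?_, ?_⟩, mem_univ _⟩
  · exact mul_nonneg ht₁.1 q.1.2.1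
  · exact mul_le_one₀ ht₁.2 q.1.2.1 q.1.2.2

end Isotopy

/-! ### Flat frames along a map and the Lagrangian condition -/

section FlatFrames

variable {n : ℕ} {M : Type u} [TopologicalSpace M]
  [ChartedSpace (EuclideanSpace ℝ (Fin (2 * n))) M] [IsManifold (𝓡 (2 * n)) ∞ M]
  {L : M → Type v} [TopologicalSpace (TotalSpace ℂ L)]
  [∀ x, NormedAddCommGroup (L x)] [∀ x, InnerProductSpace ℂ (L x)]
  [FiberBundle ℂ L] [VectorBundle ℂ ℂ L] [VectorBundle ℝ ℂ L]
  [ContMDiffVectorBundle ∞ ℂ L (𝓡 (2 * n))] {Ω : SymplecticForm n M}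
  {a : CovariantDerivative (𝓡 (2 * n)) ℂ L} {α : ∀ x, L x}

lemma contMDiff_normSq (hL : IsSmoothHermitian n L) (hα : IsSmoothSection n α) :
    ContMDiff (𝓡 (2 * n)) 𝓘(ℝ, ℝ) ∞ (fun x ↦ ‖α x‖ ^ 2) := by
  have h1 := Complex.reCLM.contDiff.contMDiff.comp (hL α α hα hα)
  refine h1.congr fun x ↦ ?_
  change _ = (inner ℂ (α x) (α x)).re
  rw [inner_self_eq_norm_sq_to_K]
  norm_cast

/-- For a hermitian connection, `Re ρ(α)` is the logarithmic derivative of `‖α‖`. -/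
lemma mvfderiv_normSq (hL : IsSmoothHermitian n L) (ha : IsPrequantum Ω a)
    (hα : IsSmoothSection n α) {x : M} (hx : α x ≠ 0) (v : TangentSpace (𝓡 (2 * n)) x) :
    mvfderiv (𝓡 (2 * n)) (fun x ↦ ‖α x‖ ^ 2) x v = 2 * (rho a α x v).re * ‖α x‖ ^ 2 := by
  have h1 := ((contMDiff_normSq hL hα) x).mdifferentiableAt (by simp)
  have h2 := (Complex.ofRealCLM.hasMFDerivAt (x := ‖α x‖ ^ 2)).comp x h1.hasMFDerivAt
  have h3 : (fun y ↦ inner ℂ (α y) (α y)) = (Complex.ofRealCLM : ℝ → ℂ) ∘ fun x ↦ ‖α x‖ ^ 2 := by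
    funext y
    change _ = ((‖α y‖ ^ 2 : ℝ) : ℂ)
    rw [inner_self_eq_norm_sq_to_K]
    norm_cast
  have h4 := ha.hermitian α α hα hα x v
  rw [h3] at h4
  have h5 : mvfderiv (𝓡 (2 * n)) ((Complex.ofRealCLM : ℝ → ℂ) ∘ fun x ↦ ‖α x‖ ^ 2) x v =
      (mvfderiv (𝓡 (2 * n)) (fun x ↦ ‖α x‖ ^ 2) x v : ℂ) := congrArg (fun T ↦ T v) h2.mfderiv
  rw [h5] at h4
  have h6 := congrArg Complex.re h4
  have h7 : inner ℂ (α x) (a α x v) = rho a α x v * ((‖α x‖ ^ 2 : ℝ) : ℂ) := by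
    rw [← rho_smul_eq v hx, inner_smul_right, inner_self_eq_norm_sq_to_K]
    norm_cast
  rw [Complex.add_re, ← inner_conj_symm, Complex.conj_re, h7, Complex.re_mul_ofReal,
    Complex.ofReal_re] at h6
  rw [h6]
  ring

/-- The quotient of two sections of the line bundle is a differentiable function. -/
lemma exists_eventuallyEq_smul (hL : IsSmoothHermitian n L) {s : ∀ x, L x}
    (hα : IsSmoothSection n α) (hs : IsSmoothSection n s) {x : M} (hx : s x ≠ 0) :
    ∃ h : M → ℂ, MDifferentiableAt (𝓡 (2 * n)) 𝓘(ℝ, ℂ) h x ∧ ∀ᶠ y in 𝓝 x, α y = h y • s y := by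
  refine ⟨fun y ↦ (inner ℂ (s y) (s y))⁻¹ * inner ℂ (s y) (α y), ?_, ?_⟩
  · have h1 := ((hL s s hs hs) x).mdifferentiableAt (by simp)
    have h2 := ((hL s α hs hα) x).mdifferentiableAt (by simp)
    have h3 : DifferentiableAt ℝ (fun z : ℂ ↦ z⁻¹) (inner ℂ (s x) (s x)) :=
      (contDiffAt_inv ℝ (inner_self_ne_zero.2 hx) (n := 1)).differentiableAt one_ne_zero
    exact (h3.mdifferentiableAt.comp x h1).mul h2
  · filter_upwards [eventually_trivializationAt_ne_zero hs hx] with y hy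
    obtain ⟨z, hz⟩ := exists_eq_smul_of_ne_zero hy.2 (α y)
    rw [hz, inner_smul_right, mul_comm, mul_assoc, mul_inv_cancel₀ (inner_self_ne_zero.2 hy.2),
      mul_one]

variable {N : Type u} [TopologicalSpace N] [ChartedSpace (EuclideanSpace ℝ (Fin n)) N]
  [IsManifold (𝓡 n) ∞ N] {ι : N → M}

/-- The section `e^l α` along `ι` is flat as soon as `dl = -ι^*ρ(α)`. -/
lemma isFlatFrame_exp_smul (hL : IsSmoothHermitian n L) (ha : IsPrequantum Ω a)
    (hα : IsSmoothSection n α) (hι : ContMDiff (𝓡 n) (𝓡 (2 * n)) ∞ ι) (hD : ∀ y, α (ι y) ≠ 0)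
    {l : N → ℂ} (hl : ContMDiff (𝓡 n) 𝓘(ℝ, ℂ) ∞ l)
    (hdl : ∀ y v, mvfderiv (𝓡 n) l y v =
      -rho a α (ι y) (mfderiv (𝓡 n) (𝓡 (2 * n)) ι y v)) :
    IsFlatFrame a ι (fun y ↦ Complex.exp (l y) • α (ι y)) := by
  have hexp : ContMDiff (𝓡 n) 𝓘(ℝ, ℂ) ∞ (fun y ↦ Complex.exp (l y)) :=
    (Complex.contDiff_exp (𝕜 := ℝ)).contMDiff.comp hl
  refine ⟨?_, fun y ↦ smul_ne_zero (Complex.exp_ne_zero _) (hD y), ?_⟩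
  · intro y
    have h1 := contMDiffAt_totalSpace.1 ((hα (ι y)).comp y (hι y))
    refine contMDiffAt_totalSpace.2 ⟨hι y, ?_⟩
    refine ContMDiffAt.congr_of_eventuallyEq
      (((contDiff_mul (𝕜 := ℝ) (𝔸 := ℂ) (n := ∞)).contMDiff.contMDiffAt).comp y
        ((hexp y).prodMk_space h1.2)) ?_
    filter_upwards [(hι y).continuousAt.eventually
      ((trivializationAt ℂ L (ι y)).open_baseSet.eventually_mem
        (mem_baseSet_trivializationAt ℂ L (ι y)))] with y' hy'
    exact ((trivializationAt ℂ L (ι y)).linear ℂ hy').map_smul _ _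
  · intro y s g hs hg hσ v
    have hσy := hσ.self_of_nhds
    have hsy : s (ι y) ≠ 0 := fun h0 ↦ by
      rw [h0, smul_zero] at hσy
      exact smul_ne_zero (Complex.exp_ne_zero _) (hD y) hσy
    obtain ⟨h, hh, hhs⟩ := exists_eventuallyEq_smul hL hα hs hsy
    have hιy := (hι y).mdifferentiableAt (by simp)
    have hs2 : MDifferentiableAt (𝓡 (2 * n)) ((𝓡 (2 * n)).prod 𝓘(ℝ, ℂ))
        (fun x ↦ (⟨x, h x • s x⟩ : TotalSpace ℂ L)) (ι y) :=
      ((hα (ι y)).mdifferentiableAt (by simp)).congr_of_eventuallyEq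
        (hhs.mono fun x hx ↦ by simp only [hx])
    have hcov : ∀ w, a α (ι y) w =
        h (ι y) • a s (ι y) w + mvfderiv (𝓡 (2 * n)) h (ι y) w • s (ι y) := by
      intro w
      rw [a.isCovariantDerivativeOnUniv.congr_of_eventuallyEq
        ((hα (ι y)).mdifferentiableAt (by simp)) hs2 univ_mem hhs,
        leibniz_complex ha.complexLinear hs hh]
    -- the coefficient `g` is the product of `e^l` with the coefficient of `α`
    have hgeq : g =ᶠ[𝓝 y] (fun y ↦ Complex.exp (l y)) * (h ∘ ι) := by
      filter_upwards [hσ, hιy.continuousAt.eventually hhs, hιy.continuousAt.eventually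
        (eventually_trivializationAt_ne_zero hs hsy)] with z hz1 hz2 hz3
      rw [hz2, smul_smul] at hz1
      exact (smul_left_injective ℂ hz3.2 hz1).symm
    have hd1 : HasMFDerivAt (𝓡 n) 𝓘(ℝ, ℂ) (fun y ↦ Complex.exp (l y)) y
        (((ContinuousLinearMap.toSpanSingleton ℂ (Complex.exp (l y))).restrictScalars ℝ).comp
          (mfderiv (𝓡 n) 𝓘(ℝ, ℂ) l y)) :=
      HasMFDerivAt.comp (f := l) y
        (((Complex.hasDerivAt_exp (l y)).hasFDerivAt.restrictScalars ℝ).hasMFDerivAt)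
        ((hl y).mdifferentiableAt (by simp)).hasMFDerivAt
    have hd2 := HasMFDerivAt.comp (f := ι) y hh.hasMFDerivAt hιy.hasMFDerivAt
    have hd3 := ((hd1.mul hd2).congr_of_eventuallyEq hgeq).mfderiv
    set w := mfderiv (𝓡 n) (𝓡 (2 * n)) ι y v
    have hdg : mvfderiv (𝓡 n) g y v = Complex.exp (l y) * mvfderiv (𝓡 (2 * n)) h (ι y) w
        + h (ι y) * (mvfderiv (𝓡 n) l y v * Complex.exp (l y)) :=
      congrArg (fun T ↦ T v) hd3
    rw [hdg, hdl, hgeq.self_of_nhds]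
    have h8 : rho a α (ι y) w • α (ι y) = a α (ι y) w := rho_smul_eq w (hD y)
    rw [hcov w, hhs.self_of_nhds, smul_smul] at h8
    have h9 : (Complex.exp (l y) * mvfderiv (𝓡 (2 * n)) h (ι y) w
        + h (ι y) * (-rho a α (ι y) w * Complex.exp (l y))) • s (ι y)
        + (Complex.exp (l y) * h (ι y)) • a s (ι y) w = Complex.exp (l y) •
          (h (ι y) • a s (ι y) w + mvfderiv (𝓡 (2 * n)) h (ι y) w • s (ι y)
            - (rho a α (ι y) w * h (ι y)) • s (ι y)) := by
      module
    exact h9.trans (by rw [h8, sub_self, smul_zero])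

/-- Along a special Bohr–Sommerfeld map, the imaginary part of `ρ(α)` vanishes. -/
lemma im_rho_eq_zero_of_isFlatFrame (hα : IsSmoothSection n α) (hD : ∀ y, α (ι y) ≠ 0)
    {σ : ∀ y : N, L (ι y)} (hσ : IsFlatFrame a ι σ) {f : N → ℝ}
    (hf : ContMDiff (𝓡 n) 𝓘(ℝ, ℝ) ∞ f) (hf0 : ∀ y, 0 < f y) {z : ℂ}
    (hσα : ∀ y, α (ι y) = (z * (f y : ℂ)) • σ y) (y : N) (v : TangentSpace (𝓡 n) y) :
    (rho a α (ι y) (mfderiv (𝓡 n) (𝓡 (2 * n)) ι y v)).im = 0 := by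
  have hz : z ≠ 0 := fun h ↦ hD y (by rw [hσα, h, zero_mul, zero_smul])
  have hr : MDifferentiableAt (𝓡 n) 𝓘(ℝ, ℝ) (fun y ↦ (f y)⁻¹) y := by
    have h1 : DifferentiableAt ℝ (fun t : ℝ ↦ t⁻¹) (f y) := differentiableAt_inv (hf0 y).ne'
    exact h1.mdifferentiableAt.comp y ((hf y).mdifferentiableAt (by simp))
  have hg : HasMFDerivAt (𝓡 n) 𝓘(ℝ, ℂ) (fun y ↦ z⁻¹ * (((f y)⁻¹ : ℝ) : ℂ)) y
      ((z⁻¹ • Complex.ofRealCLM).comp (mfderiv (𝓡 n) 𝓘(ℝ, ℝ) (fun y ↦ (f y)⁻¹) y)) :=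
    HasMFDerivAt.comp (g := fun t : ℝ ↦ z⁻¹ * (t : ℂ)) y
      ((Complex.ofRealCLM.hasFDerivAt.const_mul z⁻¹).hasMFDerivAt) hr.hasMFDerivAt
  have hfy : (f y : ℂ) ≠ 0 := by exact_mod_cast (hf0 y).ne'
  have hp := hσ.parallel y α _ hα hg.mdifferentiableAt (Eventually.of_forall fun y' ↦ by
    have hfy : (f y' : ℂ) ≠ 0 := by exact_mod_cast (hf0 y').ne'
    rw [hσα, smul_smul, Complex.ofReal_inv, mul_mul_mul_comm, inv_mul_cancel₀ hz,
      inv_mul_cancel₀ hfy, one_mul, one_smul]) v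
  have hdg : mvfderiv (𝓡 n) (fun y ↦ z⁻¹ * (((f y)⁻¹ : ℝ) : ℂ)) y v =
      z⁻¹ * ((mvfderiv (𝓡 n) (fun y ↦ (f y)⁻¹) y v : ℝ) : ℂ) := congrArg (fun T ↦ T v) hg.mfderiv
  rw [hdg] at hp
  set d : ℝ := mvfderiv (𝓡 n) (fun y ↦ (f y)⁻¹) y v
  have h1 : a α (ι y) (mfderiv (𝓡 n) (𝓡 (2 * n)) ι y v) = ((-(d * f y) : ℝ) : ℂ) • α (ι y) := by
    have h2 : ((z⁻¹ * (d : ℂ)) • α (ι y) + (z⁻¹ * (((f y)⁻¹ : ℝ) : ℂ)) •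
      a α (ι y) (mfderiv (𝓡 n) (𝓡 (2 * n)) ι y v)) = 0 := hp
    have h3 := congrArg (fun w ↦ (z * (f y : ℂ)) • w) h2
    simp only [smul_add, smul_smul, smul_zero] at h3
    have e1 : z * (f y : ℂ) * (z⁻¹ * (d : ℂ)) = (d * f y : ℝ) := by
      push_cast
      field_simp
    have e2 : z * (f y : ℂ) * (z⁻¹ * (((f y)⁻¹ : ℝ) : ℂ)) = 1 := by
      push_cast
      field_simp
    rw [e1, e2, one_smul] at h3
    rw [Complex.ofReal_neg, neg_smul]
    exact eq_neg_of_add_eq_zero_right h3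
  rw [rho_eq_of_eq_smul (hD y) h1, Complex.ofReal_im]

end FlatFrames

section Lagrangian

variable {n : ℕ} {M : Type u} [TopologicalSpace M] [T2Space M]
  [ChartedSpace (EuclideanSpace ℝ (Fin (2 * n))) M] [IsManifold (𝓡 (2 * n)) ∞ M]
  {L : M → Type v} [TopologicalSpace (TotalSpace ℂ L)]
  [∀ x, NormedAddCommGroup (L x)] [∀ x, InnerProductSpace ℂ (L x)]
  [FiberBundle ℂ L] [VectorBundle ℂ ℂ L] [VectorBundle ℝ ℂ L]
  [ContMDiffVectorBundle ∞ ℂ L (𝓡 (2 * n))] {Ω : SymplecticForm n M}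
  {a : CovariantDerivative (𝓡 (2 * n)) ℂ L} {α : ∀ x, L x}
  {N : Type u} [TopologicalSpace N] [ChartedSpace (EuclideanSpace ℝ (Fin n)) N]
  [IsManifold (𝓡 n) ∞ N] {ι : N → M}

/-- If the pullback of `Im ρ(α)` is exact, then the pullback of `2πΩ = d(Im ρ(α))` vanishes. -/
lemma symplecticForm_eq_zero_of_im_rho_eq (ha : IsPrequantum Ω a) (hα : IsSmoothSection n α)
    (hι : ContMDiff (𝓡 n) (𝓡 (2 * n)) ∞ ι) (hD : ∀ y, α (ι y) ≠ 0) {g : N → ℝ}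
    (hg : ContMDiff (𝓡 n) 𝓘(ℝ, ℝ) ∞ g)
    (hdg : ∀ y v, (rho a α (ι y) (mfderiv (𝓡 n) (𝓡 (2 * n)) ι y v)).im = mvfderiv (𝓡 n) g y v)
    (y : N) (v w : TangentSpace (𝓡 n) y) :
    Ω.toFun (ι y) (mfderiv (𝓡 n) (𝓡 (2 * n)) ι y v) (mfderiv (𝓡 n) (𝓡 (2 * n)) ι y w) = 0 := by
  set κ := extChartAt (𝓡 n) y
  have hT : IsOpen κ.target := isOpen_extChartAt_target y
  have hy : κ y ∈ κ.target := mem_extChartAt_target y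
  have hinv : κ.symm (κ y) = y := extChartAt_to_inv y
  have hκ : ∀ z ∈ κ.target, ContMDiffAt 𝓘(ℝ, EuclideanSpace ℝ (Fin n)) (𝓡 n) ∞ κ.symm z :=
    fun z hz ↦ (contMDiffOn_extChartAt_symm y).contMDiffAt (hT.mem_nhds hz)
  set f : EuclideanSpace ℝ (Fin n) → M := ι ∘ κ.symm
  have hf : ContMDiffAt 𝓘(ℝ, EuclideanSpace ℝ (Fin n)) (𝓡 (2 * n)) ∞ f (κ y) :=
    (hι _).comp _ (hκ _ hy)
  have hgc : ContDiffAt ℝ ∞ (g ∘ κ.symm) (κ y) := ((hg _).comp _ (hκ _ hy)).contDiffAt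
  have hdf : ∀ z ∈ κ.target, mfderiv 𝓘(ℝ, EuclideanSpace ℝ (Fin n)) (𝓡 (2 * n)) f z =
      (mfderiv (𝓡 n) (𝓡 (2 * n)) ι (κ.symm z)).comp
        (mfderiv 𝓘(ℝ, EuclideanSpace ℝ (Fin n)) (𝓡 n) κ.symm z) := fun z hz ↦
    mfderiv_comp z ((hι _).mdifferentiableAt (by simp)) ((hκ z hz).mdifferentiableAt (by simp))
  have key : ∀ u, (fun z ↦ (rho a α (f z)
      (mfderiv 𝓘(ℝ, EuclideanSpace ℝ (Fin n)) (𝓡 (2 * n)) f z u)).im) =ᶠ[𝓝 (κ y)]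
      fun z ↦ fderiv ℝ (g ∘ κ.symm) z u := by
    intro u
    filter_upwards [hT.mem_nhds hy] with z hz
    have h1 := (HasMFDerivAt.comp (f := κ.symm) z ((hg _).mdifferentiableAt (by simp)).hasMFDerivAt
      ((hκ z hz).mdifferentiableAt (by simp)).hasMFDerivAt).mfderiv
    rw [mfderiv_eq_fderiv] at h1
    rw [hdf z hz, h1]
    exact hdg _ _
  have hr : ∀ u, ContDiffAt ℝ ∞ (fun z ↦ rho a α (f z)
      (mfderiv 𝓘(ℝ, EuclideanSpace ℝ (Fin n)) (𝓡 (2 * n)) f z u)) (κ y) := by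
    intro u
    have h1 : ContMDiffOn 𝓘(ℝ, EuclideanSpace ℝ (Fin n)) (𝓡 (2 * n)) ∞ f κ.target :=
      fun z hz ↦ ((hι _).comp _ (hκ _ hz)).contMDiffWithinAt
    refine ((contDiffOn_rho_mfderivWithin ha.smooth hα hT.uniqueDiffOn h1 (fun z _ ↦ hD _)
      u).congr fun z hz ↦ ?_).contDiffAt (hT.mem_nhds hy)
    rw [mfderivWithin_of_isOpen hT hz]
  have him : ∀ u u', (fderiv ℝ (fun z ↦ rho a α (f z)
      (mfderiv 𝓘(ℝ, EuclideanSpace ℝ (Fin n)) (𝓡 (2 * n)) f z u)) (κ y) u').im =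
      fderiv ℝ (fderiv ℝ (g ∘ κ.symm)) (κ y) u' u := by
    intro u u'
    have h1 := (Complex.imCLM.hasFDerivAt.comp (κ y)
      ((hr u).differentiableAt (by simp)).hasFDerivAt).fderiv
    have h2 : DifferentiableAt ℝ (fderiv ℝ (g ∘ κ.symm)) (κ y) :=
      (hgc.fderiv_right (m := ∞) le_rfl).differentiableAt (by simp)
    have h3 := (h2.hasFDerivAt.clm_apply (hasFDerivAt_const u _)).fderiv
    rw [← (key u).fderiv_eq] at h3
    have h4 := congrArg (fun T ↦ T u') (h1.symm.trans h3)
    simpa using! h4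
  have hsymm : IsSymmSndFDerivAt ℝ (g ∘ κ.symm) (κ y) :=
    (hgc.of_le (m := 2) (by norm_cast)).isSymmSndFDerivAt (by simp)
  have hsurj : ∀ v : TangentSpace (𝓡 n) y, ∃ u : EuclideanSpace ℝ (Fin n),
      mfderiv 𝓘(ℝ, EuclideanSpace ℝ (Fin n)) (𝓡 (2 * n)) f (κ y) u =
        mfderiv (𝓡 n) (𝓡 (2 * n)) ι y v := by
    intro v
    refine ⟨mfderiv (𝓡 n) 𝓘(ℝ, EuclideanSpace ℝ (Fin n)) κ y v, ?_⟩
    have h1 := mfderivWithin_extChartAt_symm_comp_mfderiv_extChartAt' (I := 𝓡 n)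
      (mem_extChartAt_source y)
    rw [ModelWithCorners.range_eq_univ, mfderivWithin_univ] at h1
    rw [hdf _ hy]
    have h2 : mfderiv 𝓘(ℝ, EuclideanSpace ℝ (Fin n)) (𝓡 n) κ.symm (κ y)
        (mfderiv (𝓡 n) 𝓘(ℝ, EuclideanSpace ℝ (Fin n)) κ y v) = v := congrArg (fun T ↦ T v) h1
    refine (congrArg (mfderiv (𝓡 n) (𝓡 (2 * n)) ι (κ.symm (κ y))) h2).trans ?_
    exact congrArg (fun y' : N ↦ (mfderiv (𝓡 n) (𝓡 (2 * n)) ι y'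
      (v : EuclideanSpace ℝ (Fin n)) : EuclideanSpace ℝ (Fin (2 * n)))) hinv
  obtain ⟨v', hv'⟩ := hsurj v
  obtain ⟨w', hw'⟩ := hsurj w
  have hc := congrArg Complex.im (fderiv_rho_mfderiv_sub_swap ha hα hf (hD _) v' w')
  rw [Complex.sub_im, him, him, hsymm, sub_self] at hc
  have h5 : Ω.toFun (f (κ y)) (mfderiv 𝓘(ℝ, EuclideanSpace ℝ (Fin n)) (𝓡 (2 * n)) f (κ y) v')
      (mfderiv 𝓘(ℝ, EuclideanSpace ℝ (Fin n)) (𝓡 (2 * n)) f (κ y) w') = 0 := by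
    simpa [Real.pi_ne_zero] using hc.symm
  rw [hv', hw'] at h5
  refine Eq.trans ?_ h5
  exact congrArg (fun y' : N ↦ Ω.toFun (ι y') (mfderiv (𝓡 n) (𝓡 (2 * n)) ι y v :
    EuclideanSpace ℝ (Fin (2 * n))) (mfderiv (𝓡 n) (𝓡 (2 * n)) ι y w :
    EuclideanSpace ℝ (Fin (2 * n)))) hinv.symm

end Lagrangian

/-! ### Families of maps parametrized by time -/

section TimeFamilies

variable {m : ℕ} {M : Type u} [TopologicalSpace M] [ChartedSpace (EuclideanSpace ℝ (Fin m)) M]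
  [IsManifold (𝓡 m) ∞ M] {E' : Type} [NormedAddCommGroup E'] [NormedSpace ℝ E'] {T : Set E'}
  {F' : Type*} [NormedAddCommGroup F'] [NormedSpace ℝ F'] {H' : Type*} [TopologicalSpace H']
  {J : ModelWithCorners ℝ F' H'} {P : Type*} [TopologicalSpace P] [ChartedSpace H' P]

lemma contMDiffOn_time_comp {Φ : ℝ × M → P}
    (hΦ : ContMDiffOn (𝓘(ℝ, ℝ).prod (𝓡 m)) J ∞ Φ (Icc (0 : ℝ) 1 ×ˢ univ)) {j : E' → M}
    (hj : ContMDiffOn 𝓘(ℝ, E') (𝓡 m) ∞ j T) :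
    ContMDiffOn 𝓘(ℝ, ℝ × E') J ∞ (fun q : ℝ × E' ↦ Φ (q.1, j q.2)) (Icc (0 : ℝ) 1 ×ˢ T) :=
  hΦ.comp ((contDiff_fst.contMDiff.contMDiffOn).prodMk
    (hj.comp (contDiff_snd.contMDiff.contMDiffOn) fun _ hq ↦ hq.2)) fun _ hq ↦ ⟨hq.1, mem_univ _⟩

lemma contMDiff_time_slice {Φ : ℝ × M → P}
    (hΦ : ContMDiffOn (𝓘(ℝ, ℝ).prod (𝓡 m)) J ∞ Φ (Icc (0 : ℝ) 1 ×ˢ univ)) {t : ℝ}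
    (ht : t ∈ Icc (0 : ℝ) 1) : ContMDiff (𝓡 m) J ∞ (fun x ↦ Φ (t, x)) :=
  contMDiffOn_univ.1 (hΦ.comp ((contMDiff_const.prodMk contMDiff_id).contMDiffOn)
    fun x _ ↦ ⟨ht, mem_univ x⟩)

lemma mfderivWithin_apply_time {f : ℝ × E' → M}
    (hf : ContMDiffOn 𝓘(ℝ, ℝ × E') (𝓡 m) ∞ f (Icc (0 : ℝ) 1 ×ˢ T)) {t : ℝ}
    (ht : t ∈ Icc (0 : ℝ) 1) {z : E'} (hz : z ∈ T) {w : TangentSpace (𝓡 m) (f (t, z))}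
    (hw : HasMFDerivWithinAt 𝓘(ℝ, ℝ) (𝓡 m) (fun s ↦ f (s, z)) (Icc 0 1) t
      ((1 : ℝ →L[ℝ] ℝ).smulRight w)) :
    mfderivWithin 𝓘(ℝ, ℝ × E') (𝓡 m) f (Icc (0 : ℝ) 1 ×ˢ T) (t, z) (1, 0) = w := by
  have h1 := ((hf (t, z) ⟨ht, hz⟩).mdifferentiableWithinAt (by simp)).hasMFDerivWithinAt
  have h2 : HasMFDerivWithinAt 𝓘(ℝ, ℝ) 𝓘(ℝ, ℝ × E') (fun s : ℝ ↦ (s, z)) (Icc 0 1) t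
      (ContinuousLinearMap.inl ℝ ℝ E') :=
    (hasFDerivAt_prodMk_left t z).hasFDerivWithinAt.hasMFDerivWithinAt
  have h3 := HasMFDerivWithinAt.comp (f := fun s : ℝ ↦ (s, z)) t h1 h2 fun s hs ↦ ⟨hs, hz⟩
  have h4 := ((uniqueDiffOn_Icc (zero_lt_one' ℝ)).uniqueMDiffOn t ht).eq h3 hw
  refine (congrArg (fun A ↦ A (1 : ℝ)) h4).trans ?_
  exact one_smul ℝ w

lemma hasMFDerivAt_space_slice (hT : IsOpen T) {f : ℝ × E' → P}
    (hf : ContMDiffOn 𝓘(ℝ, ℝ × E') J ∞ f (Icc (0 : ℝ) 1 ×ˢ T)) {t : ℝ}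
    (ht : t ∈ Icc (0 : ℝ) 1) {z : E'} (hz : z ∈ T) :
    HasMFDerivAt 𝓘(ℝ, E') J (fun z' ↦ f (t, z')) z
      ((mfderivWithin 𝓘(ℝ, ℝ × E') J f (Icc (0 : ℝ) 1 ×ˢ T) (t, z)).comp
        (ContinuousLinearMap.inr ℝ ℝ E')) := by
  have h1 := ((hf (t, z) ⟨ht, hz⟩).mdifferentiableWithinAt (by simp)).hasMFDerivWithinAt
  have h2 : HasMFDerivWithinAt 𝓘(ℝ, E') 𝓘(ℝ, ℝ × E') (fun z' : E' ↦ (t, z')) T z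
      (ContinuousLinearMap.inr ℝ ℝ E') :=
    (hasFDerivAt_prodMk_right t z).hasFDerivWithinAt.hasMFDerivWithinAt
  exact (HasMFDerivWithinAt.comp (f := fun z' : E' ↦ (t, z')) z h1 h2
    fun s hs ↦ ⟨ht, hs⟩).hasMFDerivAt (hT.mem_nhds hz)

/-- Smoothness on `[0, 1] × M` can be tested in the charts of `M`. -/
lemma contMDiffOn_of_chart {k : ℝ × M → ℝ} (hk : ∀ x : M, ContDiffOn ℝ ∞
      (fun q : ℝ × EuclideanSpace ℝ (Fin m) ↦ k (q.1, (extChartAt (𝓡 m) x).symm q.2))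
      (Icc (0 : ℝ) 1 ×ˢ (extChartAt (𝓡 m) x).target)) :
    ContMDiffOn (𝓘(ℝ, ℝ).prod (𝓡 m)) 𝓘(ℝ, ℝ) ∞ k (Icc (0 : ℝ) 1 ×ˢ univ) := by
  rintro ⟨t, x⟩ ⟨ht, -⟩
  set χ := extChartAt (𝓡 m) x
  have hV : (univ ×ˢ χ.source : Set (ℝ × M)) ∈ 𝓝 (t, x) :=
    prod_mem_nhds univ_mem (extChartAt_source_mem_nhds x)
  have h1 : ContMDiffOn (𝓘(ℝ, ℝ).prod (𝓡 m)) 𝓘(ℝ, ℝ × EuclideanSpace ℝ (Fin m)) ∞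
      (fun q : ℝ × M ↦ (q.1, χ q.2)) (Icc (0 : ℝ) 1 ×ˢ χ.source) := by
    have h2 : ContMDiffOn (𝓘(ℝ, ℝ).prod (𝓡 m)) 𝓘(ℝ, EuclideanSpace ℝ (Fin m)) ∞
        (fun q : ℝ × M ↦ χ q.2) (Icc (0 : ℝ) 1 ×ˢ χ.source) := by
      refine (contMDiffOn_extChartAt (x := x)).comp contMDiff_snd.contMDiffOn fun q hq ↦ ?_
      simpa [χ] using hq.2
    exact contMDiff_fst.contMDiffOn.prodMk_space h2
  have h3 := ((hk x).contMDiffOn.comp h1 fun q hq ↦ ⟨hq.1, χ.map_source hq.2⟩).congr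
    (f₁ := k) fun q hq ↦ by
      simp only [Function.comp_apply]
      rw [χ.left_inv hq.2]
  refine (h3 (t, x) ⟨ht, mem_extChartAt_source x⟩).mono_of_mem_nhdsWithin ?_
  filter_upwards [self_mem_nhdsWithin, mem_nhdsWithin_of_mem_nhds hV] with q hq hq'
  exact ⟨hq.1, hq'.2⟩

/-- A primitive in time of a function on `[0, 1] × M` which is smooth up to the boundary is smooth
up to the boundary. -/
theorem contMDiffOn_primitive {k : ℝ × M → ℝ}
    (hk : ContMDiffOn (𝓘(ℝ, ℝ).prod (𝓡 m)) 𝓘(ℝ, ℝ) ∞ k (Icc (0 : ℝ) 1 ×ˢ univ)) :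
    ContMDiffOn (𝓘(ℝ, ℝ).prod (𝓡 m)) 𝓘(ℝ, ℝ) ∞
      (fun q : ℝ × M ↦ ∫ s in (0 : ℝ)..q.1, k (s, q.2)) (Icc (0 : ℝ) 1 ×ˢ univ) :=
  contMDiffOn_of_chart fun x ↦ contDiffOn_primitive_param (isOpen_extChartAt_target x)
    (contMDiffOn_time_comp hk (contMDiffOn_extChartAt_symm x)).contDiffOn

/-- The derivative of a map at `y`, computed in the chart at `y`. -/
lemma mfderiv_comp_extChartAt_symm_apply {y : M} {F : M → P}
    (hF : MDifferentiableAt (𝓡 m) J F y) (v : TangentSpace (𝓡 m) y) :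
    (mfderiv 𝓘(ℝ, EuclideanSpace ℝ (Fin m)) J (F ∘ (extChartAt (𝓡 m) y).symm)
      (extChartAt (𝓡 m) y y)
      (mfderiv (𝓡 m) 𝓘(ℝ, EuclideanSpace ℝ (Fin m)) (extChartAt (𝓡 m) y) y v) : F') =
      (mfderiv (𝓡 m) J F y v : F') := by
  set κ := extChartAt (𝓡 m) y
  have hy : κ y ∈ κ.target := mem_extChartAt_target y
  have hinv : κ.symm (κ y) = y := extChartAt_to_inv y
  have h1 : MDifferentiableAt 𝓘(ℝ, EuclideanSpace ℝ (Fin m)) J (F ∘ κ.symm) (κ y) := by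
    refine MDifferentiableAt.comp _ (by rwa [hinv]) ?_
    exact ((contMDiffOn_extChartAt_symm y).contMDiffAt
      ((isOpen_extChartAt_target y).mem_nhds hy)).mdifferentiableAt (n := ∞) (by simp)
  have h2 : MDifferentiableAt (𝓡 m) 𝓘(ℝ, EuclideanSpace ℝ (Fin m)) κ y :=
    (contMDiffAt_extChartAt (n := ∞)).mdifferentiableAt (by simp)
  have h3 : F =ᶠ[𝓝 y] (F ∘ κ.symm) ∘ κ := by
    filter_upwards [extChartAt_source_mem_nhds (I := 𝓡 m) y] with z hz
    simp only [Function.comp_apply]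
    rw [κ.left_inv hz]
  have h4 := ((h1.hasMFDerivAt.comp y h2.hasMFDerivAt).congr_of_eventuallyEq h3).mfderiv
  exact (congrArg (fun A : EuclideanSpace ℝ (Fin m) →L[ℝ] F' ↦ A v) h4).symm

end TimeFamilies

/-! ### The phase function of a Hamiltonian isotopy -/

section HamiltonianFlow

variable {n : ℕ} {M : Type u} [TopologicalSpace M] [T2Space M]
  [ChartedSpace (EuclideanSpace ℝ (Fin (2 * n))) M] [IsManifold (𝓡 (2 * n)) ∞ M]
  {L : M → Type v} [TopologicalSpace (TotalSpace ℂ L)]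
  [∀ x, NormedAddCommGroup (L x)] [∀ x, InnerProductSpace ℂ (L x)]
  [FiberBundle ℂ L] [VectorBundle ℂ ℂ L] [VectorBundle ℝ ℂ L]
  [ContMDiffVectorBundle ∞ ℂ L (𝓡 (2 * n))] {Ω : SymplecticForm n M}
  {a : CovariantDerivative (𝓡 (2 * n)) ℂ L} {α : ∀ x, L x}
  {φ : ℝ → M ≃ₘ^∞⟮𝓡 (2 * n), 𝓡 (2 * n)⟯ M} {H : ℝ → M → ℝ}
  {X : ℝ → ∀ x : M, TangentSpace (𝓡 (2 * n)) x}

/-- Along a Hamiltonian isotopy of a submanifold on which `Im ρ` vanishes, `Im ρ` stays exact: at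
time `t` it is the differential of the phase accumulated along the flow lines. -/
theorem im_rho_eq_mvfderiv_primitive (ha : IsPrequantum Ω a) (hα : IsSmoothSection n α)
    (hφ : ContMDiffOn (𝓘(ℝ, ℝ).prod (𝓡 (2 * n))) (𝓡 (2 * n)) ∞
      (fun q : ℝ × M ↦ φ q.1 q.2) (Icc 0 1 ×ˢ univ))
    (hH : ContMDiffOn (𝓘(ℝ, ℝ).prod (𝓡 (2 * n))) 𝓘(ℝ, ℝ) ∞
      (fun q : ℝ × M ↦ H q.1 q.2) (Icc 0 1 ×ˢ univ))
    (hX : ∀ t ∈ Icc (0 : ℝ) 1, ∀ x v, Ω.toFun x (X t x) v = mvfderiv (𝓡 (2 * n)) (H t) x v)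
    (hφX : ∀ t ∈ Icc (0 : ℝ) 1, ∀ x,
      HasMFDerivWithinAt 𝓘(ℝ, ℝ) (𝓡 (2 * n)) (fun s ↦ φ s x) (Icc 0 1) t
        ((1 : ℝ →L[ℝ] ℝ).smulRight (X t (φ t x))))
    (hφ0 : ∀ x, φ 0 x = x)
    {N : Type u} [TopologicalSpace N] [ChartedSpace (EuclideanSpace ℝ (Fin n)) N]
    [IsManifold (𝓡 n) ∞ N] {ι : N → M} (hι : ContMDiff (𝓡 n) (𝓡 (2 * n)) ∞ ι)
    (hD : ∀ t ∈ Icc (0 : ℝ) 1, ∀ y, α (φ t (ι y)) ≠ 0)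
    (h0 : ∀ y v, (rho a α (ι y) (mfderiv (𝓡 n) (𝓡 (2 * n)) ι y v)).im = 0)
    {t : ℝ} (ht : t ∈ Icc (0 : ℝ) 1) {g : N → ℝ}
    (hg : ∀ y, g y = ∫ s in (0 : ℝ)..t,
      ((rho a α (φ s (ι y)) (X s (φ s (ι y)))).im + 2 * Real.pi * H s (φ s (ι y))))
    (y : N) (hgy : MDifferentiableAt (𝓡 n) 𝓘(ℝ, ℝ) g y) (v : TangentSpace (𝓡 n) y) :
    (rho a α (φ t (ι y)) (mfderiv (𝓡 n) (𝓡 (2 * n)) (fun y ↦ φ t (ι y)) y v)).im =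
      mvfderiv (𝓡 n) g y v := by
  set κ := extChartAt (𝓡 n) y
  have hT : IsOpen κ.target := isOpen_extChartAt_target y
  have hy : κ y ∈ κ.target := mem_extChartAt_target y
  have hinv : κ.symm (κ y) = y := extChartAt_to_inv y
  have hκ : ContMDiffOn 𝓘(ℝ, EuclideanSpace ℝ (Fin n)) (𝓡 n) ∞ κ.symm κ.target :=
    contMDiffOn_extChartAt_symm y
  have hj : ContMDiffOn 𝓘(ℝ, EuclideanSpace ℝ (Fin n)) (𝓡 (2 * n)) ∞ (ι ∘ κ.symm) κ.target :=
    hι.comp_contMDiffOn hκ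
  set W : Set (ℝ × EuclideanSpace ℝ (Fin n)) := Icc (0 : ℝ) 1 ×ˢ κ.target
  set f : ℝ × EuclideanSpace ℝ (Fin n) → M := fun q ↦ φ q.1 (ι (κ.symm q.2)) with hfdef
  set h : ℝ × EuclideanSpace ℝ (Fin n) → ℝ := fun q ↦ H q.1 (f q) with hhdef
  have hf : ContMDiffOn 𝓘(ℝ, ℝ × EuclideanSpace ℝ (Fin n)) (𝓡 (2 * n)) ∞ f W :=
    contMDiffOn_time_comp hφ hj
  have hh : ContDiffOn ℝ ∞ h W :=
    (hH.comp (contDiff_fst.contMDiff.contMDiffOn.prodMk hf)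
      fun q hq ↦ ⟨hq.1, mem_univ _⟩).contDiffOn
  have hfD : ∀ q ∈ W, α (f q) ≠ 0 := fun q hq ↦ hD q.1 hq.1 _
  have htime : ∀ q ∈ W, mfderivWithin 𝓘(ℝ, ℝ × EuclideanSpace ℝ (Fin n)) (𝓡 (2 * n)) f W q (1, 0)
      = X q.1 (f q) := fun q hq ↦ mfderivWithin_apply_time hf hq.1 hq.2 (hφX q.1 hq.1 _)
  have hham : ∀ q ∈ Ioo (0 : ℝ) 1 ×ˢ κ.target, ∀ v : EuclideanSpace ℝ (Fin n),
      Ω.toFun (f q) (mfderiv 𝓘(ℝ, ℝ × EuclideanSpace ℝ (Fin n)) (𝓡 (2 * n)) f q (1, 0))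
        (mfderiv 𝓘(ℝ, ℝ × EuclideanSpace ℝ (Fin n)) (𝓡 (2 * n)) f q (0, v)) =
        fderiv ℝ h q (0, v) := by
    rintro ⟨s, z⟩ ⟨hs, hz⟩ v
    have hsI : s ∈ Icc (0 : ℝ) 1 := Ioo_subset_Icc_self hs
    have hWn : W ∈ 𝓝 (s, z) := prod_mem_nhds (Icc_mem_nhds hs.1 hs.2) (hT.mem_nhds hz)
    have h1 := hasMFDerivAt_space_slice hT hf hsI hz
    have h2 := (hasMFDerivAt_space_slice hT hh.contMDiffOn hsI hz).mfderiv
    have h3 : MDifferentiableAt (𝓡 (2 * n)) 𝓘(ℝ, ℝ) (H s) (f (s, z)) :=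
      ((contMDiff_time_slice hH hsI) _).mdifferentiableAt (by simp)
    have h4 := (HasMFDerivAt.comp (f := fun z' ↦ f (s, z')) z h3.hasMFDerivAt h1).mfderiv
    rw [mfderivWithin_of_mem_nhds hWn] at h2
    rw [mfderivWithin_of_mem_nhds hWn] at h4
    have h5 := htime (s, z) ⟨hsI, hz⟩
    rw [mfderivWithin_of_mem_nhds hWn] at h5
    rw [h5, hX s hsI, ← mfderiv_eq_fderiv]
    exact congrArg (fun A : EuclideanSpace ℝ (Fin n) →L[ℝ] ℝ ↦ A v) (h4.symm.trans h2)
  have hf0 : ∀ z ∈ κ.target, ∀ v : EuclideanSpace ℝ (Fin n), (rho a α (f (0, z))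
      (mfderivWithin 𝓘(ℝ, ℝ × EuclideanSpace ℝ (Fin n)) (𝓡 (2 * n)) f W (0, z) (0, v))).im = 0 := by
    intro z hz v
    have h1 := (hasMFDerivAt_space_slice hT hf (t := 0) (by simp) hz).mfderiv
    have h2 : (fun z' ↦ f (0, z')) = ι ∘ κ.symm := funext fun z' ↦ hφ0 _
    rw [h2, mfderiv_comp z ((hι _).mdifferentiableAt (by simp))
      ((hκ.contMDiffAt (hT.mem_nhds hz)).mdifferentiableAt (by simp))] at h1
    have h3 := h0 (κ.symm z) (mfderiv 𝓘(ℝ, EuclideanSpace ℝ (Fin n)) (𝓡 n) κ.symm z v)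
    have h4 := congrArg (fun A : EuclideanSpace ℝ (Fin n) →L[ℝ] EuclideanSpace ℝ (Fin (2 * n)) ↦
      A v) h1
    refine Eq.trans ?_ h3
    refine congrArg Complex.im ((congrArg (fun w : EuclideanSpace ℝ (Fin (2 * n)) ↦
      rho a α (f (0, z)) w) h4.symm).trans ?_)
    exact congrArg (fun x : M ↦ rho a α x (mfderiv (𝓡 n) (𝓡 (2 * n)) ι (κ.symm z)
      (mfderiv 𝓘(ℝ, EuclideanSpace ℝ (Fin n)) (𝓡 n) κ.symm z v) :
        EuclideanSpace ℝ (Fin (2 * n)))) (hφ0 _)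
  set v' : EuclideanSpace ℝ (Fin n) :=
    mfderiv (𝓡 n) 𝓘(ℝ, EuclideanSpace ℝ (Fin n)) κ y v with hv'
  have key := im_rho_eq_fderivWithin_primitive ha hα hT hf hfD hh hham hf0 ht hy v'
  set p : ℝ × EuclideanSpace ℝ (Fin n) → ℝ :=
    fun q ↦ ∫ s in (0 : ℝ)..q.1, phaseSpeed a α κ.target f h (s, q.2) with hp
  -- the right-hand side
  have hps : ContDiffOn ℝ ∞ p W :=
    contDiffOn_primitive_param hT (contDiffOn_phaseSpeed ha.smooth hα hT hf hfD hh)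
  have hpg : ∀ z ∈ κ.target, p (t, z) = g (κ.symm z) := by
    intro z hz
    rw [hg]
    refine intervalIntegral.integral_congr fun s hs ↦ ?_
    have hsI : s ∈ Icc (0 : ℝ) 1 := by
      rw [uIcc_of_le ht.1] at hs
      exact ⟨hs.1, hs.2.trans ht.2⟩
    change (rho a α (f (s, z)) _).im + 2 * Real.pi * h (s, z) = _
    rw [htime (s, z) ⟨hsI, hz⟩]
  have hr := (hasMFDerivAt_space_slice hT hps.contMDiffOn ht hy).congr_of_eventuallyEq
    (f₁ := g ∘ κ.symm) (by
      filter_upwards [hT.mem_nhds hy] with z hz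
      exact (hpg z hz).symm)
  have hrv : fderivWithin ℝ p W (t, κ y) (0, v') = mvfderiv (𝓡 n) g y v := by
    have h1 := congrArg (fun A : EuclideanSpace ℝ (Fin n) →L[ℝ] ℝ ↦ A v') hr.mfderiv
    have h2 := mfderiv_comp_extChartAt_symm_apply hgy v
    rw [mfderivWithin_eq_fderivWithin] at h1
    exact h1.symm.trans h2
  -- the left-hand side
  have hφι : ContMDiff (𝓡 n) (𝓡 (2 * n)) ∞ (fun y ↦ φ t (ι y)) := (φ t).contMDiff.comp hι
  have hlv : (mfderivWithin 𝓘(ℝ, ℝ × EuclideanSpace ℝ (Fin n)) (𝓡 (2 * n)) f W (t, κ y) (0, v') :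
      EuclideanSpace ℝ (Fin (2 * n))) =
      mfderiv (𝓡 n) (𝓡 (2 * n)) (fun y ↦ φ t (ι y)) y v := by
    have h1 := congrArg (fun A : EuclideanSpace ℝ (Fin n) →L[ℝ] EuclideanSpace ℝ (Fin (2 * n)) ↦
      A v') (hasMFDerivAt_space_slice hT hf ht hy).mfderiv
    exact h1.symm.trans
      (mfderiv_comp_extChartAt_symm_apply ((hφι y).mdifferentiableAt (by simp)) v)
  rw [hrv] at key
  refine Eq.trans ?_ key
  refine congrArg Complex.im (Eq.trans ?_ (congrArg (fun w : EuclideanSpace ℝ (Fin (2 * n)) ↦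
      rho a α (f (t, κ y)) w) hlv.symm))
  exact congrArg (fun y' : N ↦ rho a α (φ t (ι y')) (mfderiv (𝓡 n) (𝓡 (2 * n))
    (fun y ↦ φ t (ι y)) y v : EuclideanSpace ℝ (Fin (2 * n)))) hinv.symm

/-- The integrand of the phase function, cut off near the zeros of `α` by `ψ`, is smooth. -/
lemma contMDiffOn_cutoff_phaseSpeed (ha : CovariantDerivative.ContMDiffCovariantDerivative a ∞)
    (hα : IsSmoothSection n α)
    (hφ : ContMDiffOn (𝓘(ℝ, ℝ).prod (𝓡 (2 * n))) (𝓡 (2 * n)) ∞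
      (fun q : ℝ × M ↦ φ q.1 q.2) (Icc 0 1 ×ˢ univ))
    (hH : ContMDiffOn (𝓘(ℝ, ℝ).prod (𝓡 (2 * n))) 𝓘(ℝ, ℝ) ∞
      (fun q : ℝ × M ↦ H q.1 q.2) (Icc 0 1 ×ˢ univ))
    (hφX : ∀ t ∈ Icc (0 : ℝ) 1, ∀ x,
      HasMFDerivWithinAt 𝓘(ℝ, ℝ) (𝓡 (2 * n)) (fun s ↦ φ s x) (Icc 0 1) t
        ((1 : ℝ →L[ℝ] ℝ).smulRight (X t (φ t x))))
    {ψ : M → ℝ} (hψ : ContMDiff (𝓡 (2 * n)) 𝓘(ℝ, ℝ) ∞ ψ)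
    (hψ0 : ∀ x, α x = 0 → ∀ᶠ x' in 𝓝 x, ψ x' = 0) :
    ContMDiffOn (𝓘(ℝ, ℝ).prod (𝓡 (2 * n))) 𝓘(ℝ, ℝ) ∞
      (fun q : ℝ × M ↦ ψ (φ q.1 q.2) * (rho a α (φ q.1 q.2) (X q.1 (φ q.1 q.2))).im
        + 2 * Real.pi * H q.1 (φ q.1 q.2)) (Icc (0 : ℝ) 1 ×ˢ univ) := by
  refine contMDiffOn_of_chart fun x ↦ ?_
  set χ := extChartAt (𝓡 (2 * n)) x
  have hT : IsOpen χ.target := isOpen_extChartAt_target x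
  set W : Set (ℝ × EuclideanSpace ℝ (Fin (2 * n))) := Icc (0 : ℝ) 1 ×ˢ χ.target
  set f : ℝ × EuclideanSpace ℝ (Fin (2 * n)) → M := fun q ↦ φ q.1 (χ.symm q.2)
  have hf : ContMDiffOn 𝓘(ℝ, ℝ × EuclideanSpace ℝ (Fin (2 * n))) (𝓡 (2 * n)) ∞ f W :=
    contMDiffOn_time_comp hφ (contMDiffOn_extChartAt_symm x)
  have hh : ContDiffOn ℝ ∞ (fun q ↦ H q.1 (f q)) W :=
    (hH.comp (contDiff_fst.contMDiff.contMDiffOn.prodMk hf)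
      fun q hq ↦ ⟨hq.1, mem_univ _⟩).contDiffOn
  have hψf : ContDiffOn ℝ ∞ (ψ ∘ f) W := (hψ.comp_contMDiffOn hf).contDiffOn
  refine ContDiffOn.add ?_ (contDiffOn_const.mul hh)
  intro q hq
  by_cases hq0 : α (f q) = 0
  · refine (contDiffWithinAt_const (c := (0 : ℝ))).congr_of_eventuallyEq ?_ ?_
    · filter_upwards [(hf q hq).continuousWithinAt.eventually (hψ0 _ hq0)] with q' hq'
      exact mul_eq_zero_of_left hq' _
    · exact mul_eq_zero_of_left (hψ0 _ hq0).self_of_nhds _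
  · refine (hψf q hq).mul ?_
    have h1 := (contMDiffWithinAt_rho_along ha hα (contMDiffOn_mfderivWithin_apply
      ((uniqueDiffOn_Icc zero_lt_one).prod hT.uniqueDiffOn) hf (1, 0) q hq) hq0).contDiffWithinAt
    have h2 : ContDiffWithinAt ℝ ∞ (fun q ↦ rho a α (f q) (X q.1 (f q))) W q :=
      h1.congr_of_mem (fun q' hq' ↦ by
        rw [mfderivWithin_apply_time hf hq'.1 hq'.2 (hφX q'.1 hq'.1 _)]) hq
    exact Complex.imCLM.contDiff.contDiffAt.comp_contDiffWithinAt q h2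

lemma isClosed_zeroLocus (hα : IsSmoothSection n α) : IsClosed (zeroLocus α) := by
  rw [← isOpen_compl_iff, isOpen_iff_mem_nhds]
  intro x hx
  filter_upwards [eventually_trivializationAt_ne_zero hα hx] with y hy
  exact hy.2

/-- The family of phase functions: its value on the moving submanifold cancels the phase accumulated
along the flow. -/
theorem exists_phase [CompactSpace M] (ha : IsPrequantum Ω a) (hα : IsSmoothSection n α)
    (hφ : ContMDiffOn (𝓘(ℝ, ℝ).prod (𝓡 (2 * n))) (𝓡 (2 * n)) ∞
      (fun q : ℝ × M ↦ φ q.1 q.2) (Icc 0 1 ×ˢ univ))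
    (hφs : ContMDiffOn (𝓘(ℝ, ℝ).prod (𝓡 (2 * n))) (𝓡 (2 * n)) ∞
      (fun q : ℝ × M ↦ (φ q.1).symm q.2) (Icc 0 1 ×ˢ univ))
    (hH : ContMDiffOn (𝓘(ℝ, ℝ).prod (𝓡 (2 * n))) 𝓘(ℝ, ℝ) ∞
      (fun q : ℝ × M ↦ H q.1 q.2) (Icc 0 1 ×ˢ univ))
    (hφX : ∀ t ∈ Icc (0 : ℝ) 1, ∀ x,
      HasMFDerivWithinAt 𝓘(ℝ, ℝ) (𝓡 (2 * n)) (fun s ↦ φ s x) (Icc 0 1) t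
        ((1 : ℝ →L[ℝ] ℝ).smulRight (X t (φ t x))))
    {K : Set M} (hK : IsCompact K) (hD : ∀ t ∈ Icc (0 : ℝ) 1, ∀ x ∈ K, α (φ t x) ≠ 0) :
    ∃ F : ℝ → C^∞⟮𝓡 (2 * n), M; 𝓘(ℝ, ℝ), ℝ⟯,
      ContMDiffOn (𝓘(ℝ, ℝ).prod (𝓡 (2 * n))) 𝓘(ℝ, ℝ) ∞
        (fun q : ℝ × M ↦ F q.1 q.2) (Icc 0 1 ×ˢ univ) ∧
      (∀ x, F 0 x = 0) ∧ ∀ t ∈ Icc (0 : ℝ) 1, ∀ x ∈ K, F t (φ t x) = -∫ s in (0 : ℝ)..t,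
        ((rho a α (φ s x) (X s (φ s x))).im + 2 * Real.pi * H s (φ s x)) := by
  have hK' : IsCompact ((fun q : ℝ × M ↦ φ q.1 q.2) '' (Icc 0 1 ×ˢ K)) :=
    (isCompact_Icc.prod hK).image_of_continuousOn
      (hφ.continuousOn.mono (prod_mono le_rfl (subset_univ _)))
  have hdisj : Disjoint (zeroLocus α) ((fun q : ℝ × M ↦ φ q.1 q.2) '' (Icc 0 1 ×ˢ K)) := by
    rw [Set.disjoint_left]
    rintro _ hx ⟨q, hq, rfl⟩
    exact hD q.1 hq.1 q.2 hq.2 hx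
  obtain ⟨ψ, hψ0, hψ1, -⟩ := exists_contMDiffMap_zero_one_nhds_of_isClosed (n := (⊤ : ℕ∞))
    (𝓡 (2 * n)) (isClosed_zeroLocus hα) hK'.isClosed hdisj
  have hk := contMDiffOn_cutoff_phaseSpeed ha.smooth hα hφ hH hφX ψ.contMDiff
    fun x hx ↦ eventually_nhdsSet_iff_forall.1 hψ0 x hx
  set k : ℝ × M → ℝ := fun q ↦ ψ (φ q.1 q.2) * (rho a α (φ q.1 q.2) (X q.1 (φ q.1 q.2))).im
        + 2 * Real.pi * H q.1 (φ q.1 q.2) with hkdef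
  set G : ℝ × M → ℝ := fun q ↦ -∫ s in (0 : ℝ)..q.1, k (s, (φ q.1).symm q.2) with hGdef
  have hG : ContMDiffOn (𝓘(ℝ, ℝ).prod (𝓡 (2 * n))) 𝓘(ℝ, ℝ) ∞ G (Icc (0 : ℝ) 1 ×ˢ univ) := by
    have h1 := (contMDiffOn_primitive hk).comp (contMDiff_fst.contMDiffOn.prodMk hφs)
      fun q hq ↦ ⟨hq.1, mem_univ _⟩
    exact contDiff_neg.contMDiff.comp_contMDiffOn h1
  -- the time is clamped to `[0, 1]`, in order to have a smooth function for all times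
  refine ⟨fun t ↦ ⟨fun x ↦ G (projIcc (0 : ℝ) 1 zero_le_one t, x),
    contMDiff_time_slice hG (Subtype.coe_prop _)⟩, hG.congr fun q hq ↦ ?_, fun x ↦ ?_,
    fun t ht x hx ↦ ?_⟩
  · change G (projIcc (0 : ℝ) 1 zero_le_one q.1, q.2) = G q
    rw [projIcc_of_mem zero_le_one hq.1]
  · change G (projIcc (0 : ℝ) 1 zero_le_one 0, x) = 0
    rw [projIcc_left]
    simp [hGdef]
  · change G (projIcc (0 : ℝ) 1 zero_le_one t, φ t x) = _
    rw [projIcc_of_mem zero_le_one ht, hGdef]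
    simp only [Diffeomorph.symm_apply_apply]
    congr 1
    refine intervalIntegral.integral_congr fun s hs ↦ ?_
    have hsI : s ∈ Icc (0 : ℝ) 1 := by
      rw [uIcc_of_le ht.1] at hs
      exact ⟨hs.1, hs.2.trans ht.2⟩
    have h1 : ψ (φ s x) = 1 := hψ1.self_of_nhdsSet _ ⟨(s, x), ⟨hsI, hx⟩, rfl⟩
    simp only [hkdef, h1, one_mul]

end HamiltonianFlow

/-! ### Phase transformations -/

section Phase

variable {n : ℕ} {M : Type u} [TopologicalSpace M]
  [ChartedSpace (EuclideanSpace ℝ (Fin (2 * n))) M] [IsManifold (𝓡 (2 * n)) ∞ M]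
  {L : M → Type v} [TopologicalSpace (TotalSpace ℂ L)]
  [∀ x, NormedAddCommGroup (L x)] [∀ x, InnerProductSpace ℂ (L x)]
  [FiberBundle ℂ L] [VectorBundle ℂ ℂ L] [VectorBundle ℝ ℂ L] {Ω : SymplecticForm n M}
  {a : CovariantDerivative (𝓡 (2 * n)) ℂ L}

/-- A phase transformation changes `ρ(α)` by the exact form `i dF`. -/
lemma rho_phaseMul (ha : IsPrequantum Ω a) (α : SmoothSections n L)
    (F : C^∞⟮𝓡 (2 * n), M; 𝓘(ℝ, ℝ), ℝ⟯) {x : M} (hx : α.1 x ≠ 0)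
    (v : TangentSpace (𝓡 (2 * n)) x) :
    rho a (phaseMul F α).1 x v =
      rho a α.1 x v + Complex.I * (mvfderiv (𝓡 (2 * n)) F x v : ℝ) := by
  have hF : HasMFDerivAt (𝓡 (2 * n)) 𝓘(ℝ, ℝ) F x (mfderiv (𝓡 (2 * n)) 𝓘(ℝ, ℝ) F x) :=
    (F.contMDiff.mdifferentiableAt (by simp)).hasMFDerivAt
  have he : HasFDerivAt (fun r : ℝ ↦ Complex.exp (Complex.I * (r : ℂ)))
      (Complex.exp (Complex.I * (F x : ℂ)) • Complex.I • Complex.ofRealCLM) (F x) :=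
    (Complex.ofRealCLM.hasFDerivAt.const_mul Complex.I).cexp
  have hh := HasMFDerivAt.comp (g := fun r : ℝ ↦ Complex.exp (Complex.I * (r : ℂ))) x
    he.hasMFDerivAt hF
  have hdh : mvfderiv (𝓡 (2 * n)) (fun y ↦ Complex.exp (Complex.I * (F y : ℂ))) x v =
      Complex.exp (Complex.I * (F x : ℂ)) * (Complex.I * (mvfderiv (𝓡 (2 * n)) F x v : ℝ)) :=
    congrArg (fun T ↦ T v) hh.mfderiv
  have hx' : (phaseMul F α).1 x ≠ 0 := smul_ne_zero (Complex.exp_ne_zero _) hx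
  refine rho_eq_of_eq_smul hx' ?_
  have h1 := leibniz_complex (L := L) (a := a) (α := α.1)
    (h := fun y ↦ Complex.exp (Complex.I * (F y : ℂ)))
    ha.complexLinear α.2 hh.mdifferentiableAt v
  rw [hdh, ← rho_smul_eq v hx] at h1
  refine h1.trans ?_
  change _ = (_ : ℂ) • (Complex.exp (Complex.I * (F x : ℂ)) • α.1 x)
  module

/-- The phase transformations preserve the leaves `ℙ⁰(D_α)`. -/
lemma phase_mk_mem_leaf (ha : IsPrequantum Ω a) {α : SmoothSections n L} (hα : α ≠ 0)
    (F : C^∞⟮𝓡 (2 * n), M; 𝓘(ℝ, ℝ), ℝ⟯) :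
    phase F (Projectivization.mk ℂ α hα) ∈ leaf a α := by
  have h0 : phaseMul F α ≠ 0 := (map_ne_zero_iff _ (phaseMul_injective F)).2 hα
  refine ⟨⟨phaseMul F α, h0, rfl, ?_, fun x ↦ Complex.I * (F x : ℂ), ?_, fun x hx v ↦ ?_⟩,
    phaseMul F α, h0, rfl, fun x hx v ↦ ?_⟩
  · ext x
    change Complex.exp (Complex.I * (F x : ℂ)) • α.1 x = 0 ↔ α.1 x = 0
    simp
  · have h1 : ContDiff ℝ ∞ fun r : ℝ ↦ Complex.I * (r : ℂ) :=
      contDiff_const.mul Complex.ofRealCLM.contDiff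
    exact (h1.contMDiff.comp F.contMDiff).contMDiffOn
  · rw [rho_phaseMul ha α F hx]
    have h1 := HasMFDerivAt.comp (g := fun r : ℝ ↦ Complex.I * (r : ℂ)) x
      (Complex.ofRealCLM.hasFDerivAt.const_mul Complex.I).hasMFDerivAt
      (F.contMDiff.mdifferentiableAt (by simp) (x := x)).hasMFDerivAt
    exact congrArg (rho a α.1 x v + ·) (congrArg (fun T ↦ T v) h1.mfderiv).symm
  · rw [rho_phaseMul ha α F hx]
    simp

variable [ContMDiffVectorBundle ∞ ℂ L (𝓡 (2 * n))]
  {N : Type u} [TopologicalSpace N] [ChartedSpace (EuclideanSpace ℝ (Fin n)) N]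
  [IsManifold (𝓡 n) ∞ N]

/-- If the pullback of `Im ρ(α)` is `-dF`, then `e^{iF} α` is a positive multiple of a flat frame
along `ι`, namely of `e^{iF} α / ‖α‖`. -/
lemma isSpecialAlong_phaseMul (hL : IsSmoothHermitian n L) (ha : IsPrequantum Ω a)
    (α : SmoothSections n L) {ι : N → M} (hι : ContMDiff (𝓡 n) (𝓡 (2 * n)) ∞ ι)
    (hD : ∀ y, α.1 (ι y) ≠ 0) (F : C^∞⟮𝓡 (2 * n), M; 𝓘(ℝ, ℝ), ℝ⟯)
    (hF : ∀ y v, (rho a α.1 (ι y) (mfderiv (𝓡 n) (𝓡 (2 * n)) ι y v)).im =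
      mvfderiv (𝓡 n) (fun y ↦ -F (ι y)) y v) :
    IsSpecialAlong a (phaseMul F α).1 ι := by
  have hpos : ∀ y, ‖α.1 (ι y)‖ ^ 2 ≠ 0 := fun y ↦ pow_ne_zero 2 (norm_ne_zero_iff.2 (hD y))
  have hq : ContMDiff (𝓡 n) 𝓘(ℝ, ℝ) ∞ (fun y ↦ ‖α.1 (ι y)‖ ^ 2) :=
    (contMDiff_normSq hL α.2).comp hι
  have hr : ContMDiff (𝓡 n) 𝓘(ℝ, ℝ) ∞ (fun y ↦ (1 / 2) * Real.log (‖α.1 (ι y)‖ ^ 2)) := fun y ↦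
    ContMDiffAt.comp (g := fun t : ℝ ↦ (1 / 2) * Real.log t) y
      (contDiffAt_const.mul (Real.contDiffAt_log.2 (hpos y))).contMDiffAt (hq y)
  have hFι : ContMDiff (𝓡 n) 𝓘(ℝ, ℝ) ∞ (fun y ↦ -F (ι y)) :=
    contDiff_neg.contMDiff.comp (F.contMDiff.comp hι)
  set r : N → ℝ := fun y ↦ (1 / 2) * Real.log (‖α.1 (ι y)‖ ^ 2)
  -- the logarithm of the factor relating `α` and the flat frame
  set l : N → ℂ := fun y ↦ -((r y : ℂ) + ((-F (ι y) : ℝ) : ℂ) * Complex.I) with hl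
  have hA : ContDiff ℝ ∞ fun p : ℝ × ℝ ↦ -((p.1 : ℂ) + (p.2 : ℂ) * Complex.I) :=
    (((Complex.ofRealCLM.contDiff.comp contDiff_fst).add
      ((Complex.ofRealCLM.contDiff.comp contDiff_snd).mul contDiff_const))).neg
  have hls : ContMDiff (𝓡 n) 𝓘(ℝ, ℂ) ∞ l := hA.contMDiff.comp (hr.prodMk_space hFι)
  have hdr : ∀ y v, mvfderiv (𝓡 n) r y v =
      (rho a α.1 (ι y) (mfderiv (𝓡 n) (𝓡 (2 * n)) ι y v)).re := by
    intro y v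
    have h1 := HasMFDerivAt.comp (f := ι) y
      ((contMDiff_normSq hL α.2).mdifferentiableAt (by simp)).hasMFDerivAt
      (hι.mdifferentiableAt (by simp)).hasMFDerivAt
    have h2 := HasMFDerivAt.comp (g := fun t : ℝ ↦ (1 / 2) * Real.log t) y
      ((Real.hasDerivAt_log (hpos y)).hasFDerivAt.const_mul (1 / 2)).hasMFDerivAt h1
    have h3 : mvfderiv (𝓡 n) r y v = (1 / 2) * (mvfderiv (𝓡 (2 * n)) (fun x ↦ ‖α.1 x‖ ^ 2) (ι y)
        (mfderiv (𝓡 n) (𝓡 (2 * n)) ι y v) * (‖α.1 (ι y)‖ ^ 2)⁻¹) :=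
      congrArg (fun T ↦ T v) h2.mfderiv
    rw [h3, mvfderiv_normSq hL ha α.2 (hD y), mul_inv_cancel_right₀ (hpos y)]
    ring
  have hdl : ∀ y v, mvfderiv (𝓡 n) l y v =
      -rho a α.1 (ι y) (mfderiv (𝓡 n) (𝓡 (2 * n)) ι y v) := by
    intro y v
    have h1 := HasMFDerivAt.comp (g := fun t : ℝ ↦ (t : ℂ)) y
      Complex.ofRealCLM.hasFDerivAt.hasMFDerivAt (hr.mdifferentiableAt (by simp)).hasMFDerivAt
    have h2 := HasMFDerivAt.comp (g := fun t : ℝ ↦ (t : ℂ) * Complex.I) y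
      (Complex.ofRealCLM.hasFDerivAt.mul_const Complex.I).hasMFDerivAt
      (hFι.mdifferentiableAt (by simp)).hasMFDerivAt
    have h3 : mvfderiv (𝓡 n) l y v = -((mvfderiv (𝓡 n) r y v : ℝ) +
        Complex.I * (mvfderiv (𝓡 n) (fun y ↦ -F (ι y)) y v : ℝ)) :=
      congrArg (fun T ↦ T v) (h1.add h2).neg.mfderiv
    rw [h3, hdr, ← hF, mul_comm Complex.I, Complex.re_add_im]
  refine ⟨_, 0, fun y ↦ Real.exp (r y), isFlatFrame_exp_smul hL ha α.2 hι hD hls hdl,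
    Real.contDiff_exp.contMDiff.comp hr, fun y ↦ Real.exp_pos _, fun y ↦ ?_⟩
  change Complex.exp (Complex.I * (F (ι y) : ℂ)) • α.1 (ι y) = _
  rw [smul_smul, Complex.ofReal_exp, ← Complex.exp_add, ← Complex.exp_add]
  congr 2
  simp only [hl]
  push_cast
  ring

end Phase

end BohrSommerfeld

theorem mainTheorem2 {n : ℕ}
    -- the compact simply connected symplectic manifold `(M, Ω)` of dimension `2 n`
    {M : Type u} [TopologicalSpace M] [T2Space M] [CompactSpace M] [SimplyConnectedSpace M]
    [ChartedSpace (EuclideanSpace ℝ (Fin (2 * n))) M] [IsManifold (𝓡 (2 * n)) ∞ M]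
    (Ω : BohrSommerfeld.SymplecticForm n M)
    -- the hermitian line bundle `L → M` and the connection `a` with curvature `2 π i Ω`
    {L : M → Type v} [TopologicalSpace (TotalSpace ℂ L)]
    [∀ x, NormedAddCommGroup (L x)] [∀ x, InnerProductSpace ℂ (L x)]
    [FiberBundle ℂ L] [VectorBundle ℂ ℂ L] [VectorBundle ℝ ℂ L]
    [ContMDiffVectorBundle ∞ ℂ L (𝓡 (2 * n))]
    (hL : BohrSommerfeld.IsSmoothHermitian n L)
    (a : CovariantDerivative (𝓡 (2 * n)) ℂ L) (ha : BohrSommerfeld.IsPrequantum Ω a)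
    -- the topological type `N` and the homology class `A` of the Lagrangian submanifolds
    {N : Type u} [TopologicalSpace N] [T2Space N] [CompactSpace N]
    [ChartedSpace (EuclideanSpace ℝ (Fin n)) N] [IsManifold (𝓡 n) ∞ N]
    (c : BohrSommerfeld.integralHomology n N) (A : BohrSommerfeld.integralHomology n M)
    -- the point `([α₀], S 0)` and the Hamiltonian isotopy `S t` of `S 0`
    (α₀ : BohrSommerfeld.SmoothSections n L) (hα₀ : α₀ ≠ 0) (S : ℝ → Set M)
    (h₀ : (Projectivization.mk ℂ α₀ hα₀, S 0) ∈ BohrSommerfeld.universalSBS Ω a c A)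
    (hS : BohrSommerfeld.IsHamiltonianIsotopy Ω S)
    (hD : ∀ t ∈ Icc (0 : ℝ) 1, S t ∩ BohrSommerfeld.zeroLocus α₀.1 = ∅) :
    ∃ F : ℝ → C^∞⟮𝓡 (2 * n), M; 𝓘(ℝ, ℝ), ℝ⟯,
      ContMDiffOn (𝓘(ℝ, ℝ).prod (𝓡 (2 * n))) 𝓘(ℝ, ℝ) ∞
        (fun q : ℝ × M ↦ F q.1 q.2) (Icc 0 1 ×ˢ univ) ∧
      (∀ x, F 0 x = 0) ∧
      ∀ t ∈ Icc (0 : ℝ) 1,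
        (BohrSommerfeld.phase (F t) (Projectivization.mk ℂ α₀ hα₀), S t)
          ∈ BohrSommerfeld.universalSBS Ω a c A ∧
        BohrSommerfeld.phase (F t) (Projectivization.mk ℂ α₀ hα₀)
          ∈ BohrSommerfeld.leaf a α₀ := by
  obtain ⟨-, α, hα, hmk, ι, hι, hιS, σ, θ, f, hσ, hf, hf0, hσα⟩ := h₀
  obtain ⟨φ, H, X, hφ, hφs, hH, hX, hφX, hφ0, hSφ⟩ := hS
  replace hιS : range ι = S 0 := hιS
  obtain ⟨u, hu⟩ := (Projectivization.mk_eq_mk_iff ℂ α₀ α hα₀ hα).1 hmk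
  have hιs : ContMDiff (𝓡 n) (𝓡 (2 * n)) ∞ ι := hι.embedding.contMDiff
  have hK : IsCompact (S 0) := hιS ▸ isCompact_range ι.continuous
  have hιS' : ∀ y, ι y ∈ S 0 := fun y ↦ hιS ▸ mem_range_self y
  have hDφ : ∀ t ∈ Icc (0 : ℝ) 1, ∀ x ∈ S 0, α₀.1 (φ t x) ≠ 0 := fun t ht x hx hx0 ↦ by
    have h1 : φ t x ∈ S t ∩ BohrSommerfeld.zeroLocus α₀.1 :=
      ⟨hSφ t ht ▸ mem_image_of_mem _ hx, hx0⟩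
    rwa [hD t ht] at h1
  -- `α₀` is a complex multiple `u α` of the representative `α` that is special along `S 0`
  have hα₀σ : ∀ y, α₀.1 (ι y) =
      ((u : ℂ) * Complex.exp (Complex.I * (θ : ℂ)) * (f y : ℂ)) • σ y := by
    intro y
    have h1 : (u : ℂ) • α.1 (ι y) = α₀.1 (ι y) := congrFun (congrArg Subtype.val hu) (ι y)
    rw [← h1, hσα, smul_smul, mul_assoc]
  have h0 := BohrSommerfeld.im_rho_eq_zero_of_isFlatFrame α₀.2
    (fun y hy ↦ (hD 0 (by simp)).le ⟨hιS' y, hy⟩) hσ hf hf0 hα₀σ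
  obtain ⟨F, hF, hF0, hFφ⟩ :=
    BohrSommerfeld.exists_phase ha α₀.2 hφ hφs hH hφX hK hDφ
  refine ⟨F, hF, hF0, fun t ht ↦ ⟨?_, BohrSommerfeld.phase_mk_mem_leaf ha hα₀ (F t)⟩⟩
  -- the embedding `φ t ∘ ι` of `S t`
  let ιt : C(N, M) := ⟨fun y ↦ φ t (ι y), (φ t).continuous.comp ι.continuous⟩
  have hιt : ContMDiff (𝓡 n) (𝓡 (2 * n)) ∞ ιt := (φ t).contMDiff.comp hιs
  have hιtD : ∀ y, α₀.1 (ιt y) ≠ 0 := fun y ↦ hDφ t ht _ (hιS' y)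
  have hFι : ContMDiff (𝓡 n) 𝓘(ℝ, ℝ) ∞ (fun y ↦ -F t (ιt y)) :=
    contDiff_neg.contMDiff.comp ((F t).contMDiff.comp hιt)
  have hdF : ∀ y v, (BohrSommerfeld.rho a α₀.1 (ιt y)
      (mfderiv (𝓡 n) (𝓡 (2 * n)) ιt y v)).im = mvfderiv (𝓡 n) (fun y ↦ -F t (ιt y)) y v :=
    fun y v ↦ BohrSommerfeld.im_rho_eq_mvfderiv_primitive ha α₀.2 hφ hH hX hφX hφ0 hιs
      (fun s hs y ↦ hDφ s hs _ (hιS' y)) h0 ht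
      (fun y ↦ by rw [← neg_eq_iff_eq_neg.2 (hFφ t ht _ (hιS' y))]; rfl) y
      (hFι.mdifferentiableAt (by simp)) v
  have hspec := BohrSommerfeld.isSpecialAlong_phaseMul hL ha α₀ hιt hιtD (F t) hdF
  have hrange : range ιt = S t := by
    rw [hSφ t ht, ← hιS, ← range_comp]
    rfl
  have hBS : BohrSommerfeld.IsBSEmbedding Ω a c A ιt := by
    refine ⟨BohrSommerfeld.isSmoothEmbedding_diffeomorph_comp hι.embedding (φ t),
      BohrSommerfeld.symplecticForm_eq_zero_of_im_rho_eq ha α₀.2 hιt hιtD hFι hdF, ?_, ?_⟩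
    · obtain ⟨τ, -, -, hτ, -⟩ := hspec
      exact ⟨τ, hτ⟩
    · rw [← hι.homology]
      refine congrArg (fun T ↦ T c) (BohrSommerfeld.integralHomologyMap_eq_of_continuousOn
        (Φ := fun q : ℝ × N ↦ φ q.1 (ι q.2)) (f := ι) (g := ιt) ?_ ht
        (fun y ↦ (hφ0 _).symm) fun y ↦ rfl).symm
      exact hφ.continuousOn.comp (f := fun q : ℝ × N ↦ (q.1, ι q.2)) (by fun_prop)
        fun q hq ↦ ⟨hq.1, mem_univ _⟩
  exact ⟨⟨ιt, hBS, hrange⟩, BohrSommerfeld.phaseMul (F t) α₀,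
    (map_ne_zero_iff _ (BohrSommerfeld.phaseMul_injective (F t))).2 hα₀, rfl,
    ιt, hBS, hrange, hspec⟩
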